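/- **Conventions.** A function $\gamma:[0,\infty)\to[0,\infty)$ is of class $K$ if it is continuous, strictly increasing and $\gamma(0)=0$; it is of class $K_\infty$ if moreover it is unbounded. A function $\beta:[0,\infty)^2\to[0,\infty)$ is of class $KL$ if $\beta(\cdot,t)$ is of class $K$ for each $t$ and $\beta(s,\cdot)$ is decreasing (not necessarily strictly) with limit $0$ at infinity for each $s$. $Id$ is the identity on $[0,\infty)$ and $(Id+\rho)^2=(Id+\rho)\circ(Id+\rho)$. All state, input and output spaces are finite-dimensional real vector spaces with arbitrary norms $|\cdot|$; pairs of vectors are measured by the $\ell^p$-combination of the norms of the two entries, for one fixed $p\in[1,\infty]$. $\|u\|$ is the essential supremum of $|u(t)|$ over $t\ge 0$, and $u_t$ is the function equal to $u$ on $[0,t]$ and to $0$ elsewhere. Controls are measurable and essentially bounded; solutions of $\dot x=f(x,u)$ are Carathéodory solutions. Consider a system $\dot x=f(x,u)$, $y=h(x,u)$ with $f,h$ smooth. * It has the *UO property with couple* $(\alpha^0,D^0)$, where $\alpha^0$ is of class $K$ and $D^0\ge 0$, if for each $0<T\le+\infty$, each control $u$ on $[0,T)$ and each corresponding solution $x$,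 right maximally defined on $[0,T')$, $$|x(t)|\le\alpha^0\big(|x(0)|+\|(u_t,y_t)\|\big)+D^0\qquad\text{for all }t\in[0,T').$$ It has the *UO property* if it has it with some couple. * It is *IOpS with the triple* $(\beta,\gamma,d)$, where $\beta$ is of class $KL$, $\gamma$ (the gain from $u$ to $y$) is of class $K$ and $d\ge0$, if for each initial condition, each control $u$ on $[0,\infty)$ and almost every $t$ in the right maximal interval of definition of the corresponding solution, $$|y(t)|\le\beta(|x(0)|,t)+\gamma(\|u\|)+d .$$ It is *IOpS* if it is so with some triple, and *IOS* if it is so with some triple with $d=0$. **Theorem.** Consider the interconnected system $$\dot x_1=f_1(x_1,y_2,u_1),\quad y_1=h_1(x_1,y_2,u_1),\qquad \dot x_2=f_2(x_2,y_1,u_2),\quad y_2=h_2(x_2,y_1,u_2),$$ with $f_1,f_2,h_1,h_2$ smooth, and suppose there is a smooth function $h$ such that, for all $(x_1,x_2,u_1,u_2)$, $(y_1,y_2)=h(x_1,x_2,u_1,u_2)$ is the unique solution of $$y_1=h_1(x_1,h_2(x_2,y_1,u_2),u_1),\qquad y_2=h_2(x_2,h_1(x_1,y_2,u_1),u_2).$$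 Suppose that the $x_1$-subsystem with input $(y_2,u_1)$ and output $y_1$, and the $x_2$-subsystem with input $(y_1,u_2)$ and output $y_2$, the inputs being arbitrary controls on $[0,\infty)$, satisfy, for almost every $t$ in the right maximal interval of definition of the solution, $$|y_1(t)|\le\beta_1(|x_1(0)|,t)+\gamma_1^y(\|y_{2t}\|)+\gamma_1^u(\|u_1\|)+d_1,$$ $$|y_2(t)|\le\beta_2(|x_2(0)|,t)+\gamma_2^y(\|y_{1t}\|)+\gamma_2^u(\|u_2\|)+d_2,$$ where $\beta_i$ is of class $KL$, $\gamma_i^y,\gamma_i^u$ are of class $K$ and $d_i\ge 0$. Suppose also that these two subsystems have the UO property with couples $(\alpha_1^0,D_1^0)$ and $(\alpha_2^0,D_2^0)$ respectively. Let $\rho_1,\rho_2$ be of class $K_\infty$ and $s_l\ge0$ such that, for all $s\ge s_l$, $$(Id+\rho_2)\circ\gamma_2^y\circ(Id+\rho_1)\circ\gamma_1^y(s)\le s,\qquad (Id+\rho_1)\circ\gamma_1^y\circ(Id+\rho_2)\circ\gamma_2^y(s)\le s .$$ Then the interconnected system with input $u=(u_1,u_2)$, output $y=(y_1,y_2)$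 and state $x=(x_1,x_2)$ is IOpS and has the UO property. If $s_l=d_1=d_2=D_1^0=D_2^0=0$, it is IOS and has the UO property with $D^0=0$. More specifically, for each pair of class $K_\infty$ functions $(\rho_3,r_3^1)$ there exist $\beta_1',\beta_2'$ of class $KL$, $r_3^2$ of class $K$ and $d_1',d_2'\ge 0$, with $d_1'=d_2'=0$ when $s_l=d_1=d_2=D_1^0=D_2^0=0$, such that the interconnected system is IOpS with the triple $(\beta_1'+\beta_2',\ r_1+r_2+r_3^1+r_3^2,\ d_1'+d_2')$, where $$r_1=(Id+\rho_1^{-1})\circ(Id+\rho_3)^2\circ\big[\gamma_1^u+\gamma_1^y\circ(Id+\rho_2^{-1})\circ(Id+\rho_3)^2\circ\gamma_2^u\big],$$ $$r_2=(Id+\rho_2^{-1})\circ(Id+\rho_3)^2\circ\big[\gamma_2^u+\gamma_2^y\circ(Id+\rho_1^{-1})\circ(Id+\rho_3)^2\circ\gamma_1^u\big],$$ and moreover, with the same functions and constants, it is IOpS from $u$ to $y_1$ with the triple $(\beta_1',r_1+r_3^1,d_1')$ and from $u$ to $y_2$ with the triple $(\beta_2',r_2+r_3^2,d_2')$. -/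

import Mathlib

open MeasureTheory Filter Topology
open scoped NNReal ENNReal

noncomputable section

/-! ### Comparison functions -/

/-- Class `K`: continuous, strictly increasing functions `[0,∞) → [0,∞)` vanishing at `0`. -/
structure IsClassK (γ : ℝ≥0 → ℝ≥0) : Prop where
  continuous : Continuous γ
  strictMono : StrictMono γ
  map_zero : γ 0 = 0

/-- Class `K∞`: unbounded functions of class `K`. -/
structure IsClassKInf (ρ : ℝ≥0 → ℝ≥0) : Prop extends IsClassK ρ where
  tendsto_atTop : Tendsto ρ atTop atTop

/-- Class `KL`: `β(·,t)` is of class `K` for each `t`, and `β(s,·)` is decreasing with limit `0`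
for each `s`. -/
structure IsClassKL (β : ℝ≥0 → ℝ≥0 → ℝ≥0) : Prop where
  classK : ∀ t, IsClassK fun s => β s t
  antitone : ∀ s, Antitone (β s)
  tendsto_zero : ∀ s, Tendsto (β s) atTop (𝓝 0)

/-- `Id + ρ`. -/
def idAdd (ρ : ℝ≥0 → ℝ≥0) : ℝ≥0 → ℝ≥0 := fun s => s + ρ s

/-- The inverse function `ρ⁻¹`; it is only used for `ρ` of class `K∞`, where it is a two-sided
inverse by the lemmas below. -/
def funInv (ρ : ℝ≥0 → ℝ≥0) : ℝ≥0 → ℝ≥0 := Function.invFun ρ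

theorem IsClassKInf.surjective {ρ : ℝ≥0 → ℝ≥0} (hρ : IsClassKInf ρ) : Function.Surjective ρ := by
  intro y
  obtain ⟨b, hb⟩ := (hρ.tendsto_atTop.eventually_ge_atTop y).exists
  have h : y ∈ Set.Icc (ρ 0) (ρ b) := ⟨by rw [hρ.map_zero]; exact zero_le, hb⟩
  obtain ⟨x, -, hx⟩ := intermediate_value_Icc (zero_le : (0 : ℝ≥0) ≤ b) hρ.continuous.continuousOn h
  exact ⟨x, hx⟩

theorem IsClassKInf.funInv_apply {ρ : ℝ≥0 → ℝ≥0} (hρ : IsClassKInf ρ) (s : ℝ≥0) :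
    funInv ρ (ρ s) = s :=
  Function.leftInverse_invFun hρ.strictMono.injective s

theorem IsClassKInf.apply_funInv {ρ : ℝ≥0 → ℝ≥0} (hρ : IsClassKInf ρ) (s : ℝ≥0) :
    ρ (funInv ρ s) = s :=
  Function.rightInverse_invFun hρ.surjective s

/-- The gain
`(Id + ρ₁⁻¹) ∘ (Id + ρ₃)² ∘ [γ₁ᵘ + γ₁ʸ ∘ (Id + ρ₂⁻¹) ∘ (Id + ρ₃)² ∘ γ₂ᵘ]`,
where squares are meant with respect to composition. -/
def loopGain (ρ₁ ρ₂ ρ₃ γ₁y γ₁u γ₂u : ℝ≥0 → ℝ≥0) : ℝ≥0 → ℝ≥0 :=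
  idAdd (funInv ρ₁) ∘ (idAdd ρ₃)^[2] ∘
    (γ₁u + γ₁y ∘ idAdd (funInv ρ₂) ∘ (idAdd ρ₃)^[2] ∘ γ₂u)

/-! ### Signals and solutions -/

/-- The time interval `[0,T)`, where `T ≤ +∞`. -/
def timeInterval (T : EReal) : Set ℝ := {t | 0 ≤ t ∧ (t : EReal) < T}

section Signals

variable {E : Type*} [NormedAddCommGroup E]

/-- `‖u‖`, the essential supremum of `|u(t)|` over `t ≥ 0` (used for essentially bounded `u`). -/
def essNorm (u : ℝ → E) : ℝ≥0 := (eLpNorm u ⊤ (volume.restrict (Set.Ici 0))).toNNReal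

/-- The truncation `u_t`: equal to `u` on `[0,t]` and to zero elsewhere. -/
def truncate (u : ℝ → E) (t : ℝ) : ℝ → E := (Set.Icc 0 t).indicator u

/-- `u` is a measurable, essentially bounded control on `[0,T)`; its values outside `[0,T)` are
irrelevant. -/
def IsControl (u : ℝ → E) (T : EReal) : Prop := MemLp u ⊤ (volume.restrict (timeInterval T))

end Signals

section Systems

variable {X U Y : Type*} [NormedAddCommGroup X] [NormedSpace ℝ X]

/-- `x` is a (Carathéodory) solution of `ẋ = f(x,u)` on `[0,T)`: it is continuous there and
satisfies the integral equation, the integrand being integrable on every `[0,t]`, `t < T`. -/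
structure IsSolution (f : X → U → X) (u : ℝ → U) (x : ℝ → X) (T : EReal) : Prop where
  continuousOn : ContinuousOn x (timeInterval T)
  intervalIntegrable : ∀ t ∈ timeInterval T,
    IntervalIntegrable (fun s => f (x s) (u s)) volume 0 t
  integral_eq : ∀ t ∈ timeInterval T, x t = x 0 + ∫ s in (0 : ℝ)..t, f (x s) (u s)

/-- For a control `u` on `[0,T)`, the solution `x` of `ẋ = f(x,u)` is right maximally defined on
`[0,T')`: it cannot be continued as a solution beyond `T'` inside `[0,T)`. -/
structure IsMaximalSolution (f : X → U → X) (u : ℝ → U) (T : EReal) (x : ℝ → X) (T' : EReal) :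
    Prop where
  pos : 0 < T'
  le : T' ≤ T
  isSolution : IsSolution f u x T'
  maximal : ∀ (T'' : EReal) (z : ℝ → X), T'' ≤ T → IsSolution f u z T'' →
    Set.EqOn z x (timeInterval T') → T'' ≤ T'

variable [NormedAddCommGroup U] [NormedAddCommGroup Y]

/-! ### Stability notions for `ẋ = f(x,u)`, `y = h(x,u)`

All finite-dimensional vector spaces carry an arbitrary norm, and a pair of vectors is measured by
the `ℓ^p` combination of the two norms, for a fixed `p ∈ [1,∞]`.  Since the norm of a control is an
essential supremum and `y(t) = h(x(t),u(t))` involves the value `u(t)`, estimates on `y(t)` are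
required for almost every `t`. -/

/-- The boundedness observability property with the couple `(α, D)`. -/
structure IsUOCouple (p : ℝ≥0∞) [Fact (1 ≤ p)] (f : X → U → X) (h : X → U → Y)
    (α : ℝ≥0 → ℝ≥0) (D : ℝ≥0) : Prop where
  classK : IsClassK α
  bound : ∀ (T : EReal) (u : ℝ → U), 0 < T → IsControl u T →
    ∀ (x : ℝ → X) (T' : EReal), IsMaximalSolution f u T x T' →
      ∀ t ∈ timeInterval T',
        ‖x t‖₊ ≤ α (‖x 0‖₊ +
          essNorm (truncate (fun s => WithLp.toLp p (u s, h (x s) (u s))) t)) + D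

/-- The boundedness observability (UO) property. -/
def IsUO (p : ℝ≥0∞) [Fact (1 ≤ p)] (f : X → U → X) (h : X → U → Y) : Prop :=
  ∃ (α : ℝ≥0 → ℝ≥0) (D : ℝ≥0), IsUOCouple p f h α D

/-- Input-to-output practical stability with the triple `(β, γ, d)`. -/
structure IsIOpSTriple (f : X → U → X) (h : X → U → Y)
    (β : ℝ≥0 → ℝ≥0 → ℝ≥0) (γ : ℝ≥0 → ℝ≥0) (d : ℝ≥0) : Prop where
  classKL : IsClassKL β
  classK : IsClassK γ
  bound : ∀ u : ℝ → U, IsControl u ⊤ →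
    ∀ (x : ℝ → X) (T' : EReal), IsMaximalSolution f u ⊤ x T' →
      ∀ᵐ t ∂(volume.restrict (timeInterval T')),
        ‖h (x t) (u t)‖₊ ≤ β ‖x 0‖₊ t.toNNReal + γ (essNorm u) + d

/-- Input-to-output practical stability (IOpS). -/
def IsIOpS (f : X → U → X) (h : X → U → Y) : Prop :=
  ∃ (β : ℝ≥0 → ℝ≥0 → ℝ≥0) (γ : ℝ≥0 → ℝ≥0) (d : ℝ≥0), IsIOpSTriple f h β γ d

/-- Input-to-output stability (IOS). -/
def IsIOS (f : X → U → X) (h : X → U → Y) : Prop :=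
  ∃ (β : ℝ≥0 → ℝ≥0 → ℝ≥0) (γ : ℝ≥0 → ℝ≥0), IsIOpSTriple f h β γ 0

end Systems

/-! ### Subsystems and their interconnection -/

/-- A map of `(x, v, u)` seen as a map of the state `x` and the joint input `(v, u)`. -/
def jointInput {X V U Z : Type*} (p : ℝ≥0∞) (f : X → V → U → Z) : X → WithLp p (V × U) → Z :=
  fun x w => f x w.fst w.snd

/-- Input-to-output practical stability of `ẋ = f(x,v,u)`, `y = h(x,v,u)` with the triple
`(β, (γʸ, γᵘ), d)`, the input `v` (the output of another system) having gain `γʸ` and the external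
input `u` having gain `γᵘ`:
`|y(t)| ≤ β(|x(0)|,t) + γʸ(‖v_t‖) + γᵘ(‖u‖) + d`. -/
structure IsIOpSTripleTwoInputs {X V U Y : Type*} [NormedAddCommGroup X] [NormedSpace ℝ X]
    [NormedAddCommGroup V] [NormedAddCommGroup U] [NormedAddCommGroup Y]
    (p : ℝ≥0∞) (f : X → V → U → X) (h : X → V → U → Y)
    (β : ℝ≥0 → ℝ≥0 → ℝ≥0) (γy γu : ℝ≥0 → ℝ≥0) (d : ℝ≥0) : Prop where
  classKL : IsClassKL β
  classK_y : IsClassK γy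
  classK_u : IsClassK γu
  bound : ∀ (v : ℝ → V) (u : ℝ → U), IsControl v ⊤ → IsControl u ⊤ →
    ∀ (x : ℝ → X) (T' : EReal),
      IsMaximalSolution (jointInput p f) (fun t => WithLp.toLp p (v t, u t)) ⊤ x T' →
      ∀ᵐ t ∂(volume.restrict (timeInterval T')),
        ‖h (x t) (v t) (u t)‖₊ ≤
          β ‖x 0‖₊ t.toNNReal + γy (essNorm (truncate v t)) + γu (essNorm u) + d

section Interconnection

variable {X₁ X₂ U₁ U₂ Y₁ Y₂ : Type*}

/-- For all states and external inputs, `(y₁,y₂) = h(x₁,x₂,u₁,u₂)` is the (unique) solution of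
`y₁ = h₁(x₁, h₂(x₂,y₁,u₂), u₁)`, `y₂ = h₂(x₂, h₁(x₁,y₂,u₁), u₂)`. -/
def IsOutputSolution (h₁ : X₁ → Y₂ → U₁ → Y₁) (h₂ : X₂ → Y₁ → U₂ → Y₂)
    (h : X₁ → X₂ → U₁ → U₂ → Y₁ × Y₂) : Prop :=
  ∀ x₁ x₂ u₁ u₂ y₁ y₂,
    (y₁, y₂) = h x₁ x₂ u₁ u₂ ↔
      (y₁ = h₁ x₁ (h₂ x₂ y₁ u₂) u₁ ∧ y₂ = h₂ x₂ (h₁ x₁ y₂ u₁) u₂)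

/-- The right-hand side of the interconnection `ẋ₁ = f₁(x₁,y₂,u₁)`, `ẋ₂ = f₂(x₂,y₁,u₂)` with state
`x = (x₁,x₂)` and input `u = (u₁,u₂)`, where `(y₁,y₂) = h(x₁,x₂,u₁,u₂)`. -/
def interField (p : ℝ≥0∞) (f₁ : X₁ → Y₂ → U₁ → X₁) (f₂ : X₂ → Y₁ → U₂ → X₂)
    (h : X₁ → X₂ → U₁ → U₂ → Y₁ × Y₂) :
    WithLp p (X₁ × X₂) → WithLp p (U₁ × U₂) → WithLp p (X₁ × X₂) :=
  fun x u => WithLp.toLp p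
    (f₁ x.fst (h x.fst x.snd u.fst u.snd).2 u.fst, f₂ x.snd (h x.fst x.snd u.fst u.snd).1 u.snd)

/-- The output `y = (y₁,y₂)` of the interconnection. -/
def interOutput (p : ℝ≥0∞) (h : X₁ → X₂ → U₁ → U₂ → Y₁ × Y₂) :
    WithLp p (X₁ × X₂) → WithLp p (U₁ × U₂) → WithLp p (Y₁ × Y₂) :=
  fun x u => WithLp.toLp p (h x.fst x.snd u.fst u.snd)

/-- The output component `y₁` of the interconnection. -/
def interOutput₁ (p : ℝ≥0∞) (h : X₁ → X₂ → U₁ → U₂ → Y₁ × Y₂) :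
    WithLp p (X₁ × X₂) → WithLp p (U₁ × U₂) → Y₁ :=
  fun x u => (h x.fst x.snd u.fst u.snd).1

/-- The output component `y₂` of the interconnection. -/
def interOutput₂ (p : ℝ≥0∞) (h : X₁ → X₂ → U₁ → U₂ → Y₁ × Y₂) :
    WithLp p (X₁ × X₂) → WithLp p (U₁ × U₂) → Y₂ :=
  fun x u => (h x.fst x.snd u.fst u.snd).2

end Interconnection

end

/-!
The proof works with trajectories on bounded intervals `[0,T)` strictly inside the interval of
definition of a solution, where the outputs are essentially bounded and so are admissible inputs for
the other subsystem. No global existence is needed: a piece of a solution extends to a maximal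
solution of the subsystem by Zorn's lemma (`IsSolution.exists_isMaximalSolution`), and by time
invariance the output estimates can be restarted at any time (`IsIOpSTripleTwoInputs.restart`). All
that is kept of a solution is the bundle of inequalities `LoopTrajectory` between the norms of its
states and outputs.

* *Small gain for numbers* (`small_gain_le`). If `a₁ ≤ A₁ + γ₁ʸ(a₂)` and `a₂ ≤ A₂ + γ₂ʸ(a₁)`, then
  `a₁ ≤ s_l + (Id+ρ₁⁻¹)(A₁ + γ₁ʸ((Id+ρ₂⁻¹)(A₂)))`. The weak triangle inequality with `ρ₃` splits
  this into the prescribed gain of the external input and a contribution of the initial states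
  (`small_gain_bound_le`).
* *Boundedness* (`LoopData.aeBound_transient`). Applied to the essential suprema over `[0,T)`, this
  bounds the output by `gain(U) + M(r) + offset`, where `U` bounds the input, `r` bounds the initial
  states and `M` is of class `K`. The UO property then bounds the states.
* *Attractivity* (`LoopData.exists_uniformBound_Icc`). Since the states are bounded and the
  estimates can be restarted, the limits, as time grows, of the best bounds uniform over all
  trajectories satisfy the same inequalities without the `β`-terms. So the output is eventually below
  `gain(U) + offset + ε`, with a waiting time uniform for `r` fixed and `U` in a compact interval.
* *Class `KL`* (`LoopData.exists_classKL_bound`). If `r₃₁(U) ≥ M(r)`, the boundedness estimate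
  already has the required form; otherwise `U ≤ r₃₁⁻¹(M(r))` lies in a compact interval depending
  on `r` only. Hence the excess of the output over `gain(U) + r₃₁(U) + offset` tends to zero
  uniformly for fixed `r` and is at most `M(r)`, and such a family has a majorant of class `KL`
  (`exists_classKL_majorant`).

The UO property of the interconnection (`IsStableLoop.isUOCouple`) follows from those of the
subsystems, whose inputs and outputs are components of the input and output of the interconnection.
-/

noncomputable section

/-! ### Comparison functions -/

namespace IsClassK

variable {γ δ : ℝ≥0 → ℝ≥0}

theorem id : IsClassK fun s => s := ⟨continuous_id, strictMono_id, rfl⟩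

theorem monotone (h : IsClassK γ) : Monotone γ := h.strictMono.monotone

theorem add (h : IsClassK γ) (h' : IsClassK δ) : IsClassK (γ + δ) :=
  ⟨h.continuous.add h'.continuous, fun _ _ hab => add_lt_add (h.strictMono hab) (h'.strictMono hab),
    by simp [h.map_zero, h'.map_zero]⟩

theorem comp (h : IsClassK γ) (h' : IsClassK δ) : IsClassK (γ ∘ δ) :=
  ⟨h.continuous.comp h'.continuous, h.strictMono.comp h'.strictMono,
    by simp [h.map_zero, h'.map_zero]⟩

theorem idAdd (h : IsClassK γ) : IsClassK (idAdd γ) := id.add h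

end IsClassK

theorem IsClassKInf.funInv {ρ : ℝ≥0 → ℝ≥0} (hρ : IsClassKInf ρ) : IsClassK (funInv ρ) := by
  set e : ℝ≥0 ≃o ℝ≥0 := hρ.strictMono.orderIsoOfSurjective ρ hρ.surjective with he
  have key : _root_.funInv ρ = e.symm := by
    funext s
    apply hρ.strictMono.injective
    rw [hρ.apply_funInv]
    exact (e.apply_symm_apply s).symm
  rw [key]
  refine ⟨e.symm.continuous, e.symm.strictMono, ?_⟩
  have : e 0 = 0 := hρ.map_zero
  rw [e.symm_apply_eq, this]

theorem le_idAdd (ρ : ℝ≥0 → ℝ≥0) (s : ℝ≥0) : s ≤ idAdd ρ s := le_self_add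

theorem IsClassKInf.id : IsClassKInf fun s => s := ⟨IsClassK.id, tendsto_id⟩

theorem isClassK_loopGain {ρ₁ ρ₂ ρ₃ γ₁y γ₁u γ₂u : ℝ≥0 → ℝ≥0} (hρ₁ : IsClassKInf ρ₁)
    (hρ₂ : IsClassKInf ρ₂) (hρ₃ : IsClassKInf ρ₃) (hy : IsClassK γ₁y) (hu₁ : IsClassK γ₁u)
    (hu₂ : IsClassK γ₂u) : IsClassK (loopGain ρ₁ ρ₂ ρ₃ γ₁y γ₁u γ₂u) := by
  have h3 : IsClassK ((idAdd ρ₃)^[2]) := hρ₃.idAdd.comp hρ₃.idAdd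
  exact hρ₁.funInv.idAdd.comp (h3.comp (hu₁.add (hy.comp (hρ₂.funInv.idAdd.comp (h3.comp hu₂)))))

theorem IsClassKL.add {β β' : ℝ≥0 → ℝ≥0 → ℝ≥0} (h : IsClassKL β) (h' : IsClassKL β') :
    IsClassKL (β + β') :=
  ⟨fun t => (h.classK t).add (h'.classK t), fun s => (h.antitone s).add (h'.antitone s),
    fun s => (add_zero (0 : ℝ≥0)) ▸ (h.tendsto_zero s).add (h'.tendsto_zero s)⟩

/-- A sum is at most the larger of `(Id + ρ) a` and `(Id + ρ⁻¹) b`. -/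
theorem add_le_max_idAdd {ρ : ℝ≥0 → ℝ≥0} (hρ : IsClassKInf ρ) (a b : ℝ≥0) :
    a + b ≤ max (idAdd ρ a) (idAdd (funInv ρ) b) := by
  rcases le_total b (ρ a) with h | h
  · exact le_max_of_le_left (add_le_add le_rfl h)
  · apply le_max_of_le_right
    have : a ≤ funInv ρ b := by
      have := hρ.funInv.monotone h
      rwa [hρ.funInv_apply] at this
    rw [add_comm]
    exact add_le_add le_rfl this

/-- The weak triangle inequality `G (a + b) ≤ G ((Id + ρ) a) + G ((Id + ρ⁻¹) b)`. -/
theorem Monotone.weak_triangle {G : ℝ≥0 → ℝ≥0} (hG : Monotone G) {ρ : ℝ≥0 → ℝ≥0}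
    (hρ : IsClassKInf ρ) (a b : ℝ≥0) :
    G (a + b) ≤ G (idAdd ρ a) + G (idAdd (funInv ρ) b) :=
  (hG (add_le_max_idAdd hρ a b)).trans
    (by rw [hG.map_max]; exact max_le_add_of_nonneg zero_le zero_le)

/-! ### The small-gain argument for numbers -/

/-- Two nonnegative numbers bounding each other through gains that satisfy the small-gain condition
above `sl` are bounded in terms of the constants alone. -/
theorem small_gain_le {γ₁y γ₂y ρ₁ ρ₂ : ℝ≥0 → ℝ≥0} {sl : ℝ≥0} (hy₁ : IsClassK γ₁y)
    (hρ₁ : IsClassKInf ρ₁) (hρ₂ : IsClassKInf ρ₂)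
    (hgain : ∀ s, sl ≤ s → (idAdd ρ₁ ∘ γ₁y ∘ idAdd ρ₂ ∘ γ₂y) s ≤ s) {A₁ A₂ a₁ a₂ : ℝ≥0}
    (h₁ : a₁ ≤ A₁ + γ₁y a₂) (h₂ : a₂ ≤ A₂ + γ₂y a₁) :
    a₁ ≤ sl + idAdd (funInv ρ₁) (A₁ + γ₁y (idAdd (funInv ρ₂) A₂)) := by
  rcases le_total a₁ sl with hs | hs
  · exact hs.trans le_self_add
  set A := A₁ + γ₁y (idAdd (funInv ρ₂) A₂) with hA
  set w := γ₁y (idAdd ρ₂ (γ₂y a₁)) with hw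
  have h3 : a₁ ≤ A + w := by
    calc a₁ ≤ A₁ + γ₁y (γ₂y a₁ + A₂) := by
          refine h₁.trans (add_le_add le_rfl (hy₁.monotone ?_)); rwa [add_comm]
      _ ≤ A₁ + (w + γ₁y (idAdd (funInv ρ₂) A₂)) :=
          add_le_add le_rfl (hy₁.monotone.weak_triangle hρ₂ _ _)
      _ = A + w := by rw [hA]; ring
  have h4 : w + ρ₁ w ≤ a₁ := hgain a₁ hs
  have h5 : ρ₁ w ≤ A := by
    have := h4.trans h3
    rw [add_comm] at this
    exact le_of_add_le_add_right this
  have h6 : w ≤ funInv ρ₁ A := by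
    have := hρ₁.funInv.monotone h5
    rwa [hρ₁.funInv_apply] at this
  exact h3.trans ((add_le_add le_rfl h6).trans le_add_self)

/-- The contribution of the parts `b₁`, `b₂` of the constants that do not come from the external
inputs to the small-gain bound, once the input part has been split off with the help of `ρ₃`. -/
def offsetGain (ρ₁ ρ₂ ρ₃ γ₁y : ℝ≥0 → ℝ≥0) (b₁ b₂ : ℝ≥0) : ℝ≥0 :=
  idAdd (funInv ρ₁) (idAdd (funInv ρ₃)
    (b₁ + γ₁y (idAdd (funInv ρ₂) (idAdd (funInv ρ₃) b₂))))

section offsetGain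

variable {ρ₁ ρ₂ ρ₃ γ₁y : ℝ≥0 → ℝ≥0}

theorem offsetGain_zero (hρ₁ : IsClassKInf ρ₁) (hρ₂ : IsClassKInf ρ₂) (hρ₃ : IsClassKInf ρ₃)
    (hy : IsClassK γ₁y) : offsetGain ρ₁ ρ₂ ρ₃ γ₁y 0 0 = 0 := by
  simp [offsetGain, hρ₁.funInv.idAdd.map_zero, hρ₂.funInv.idAdd.map_zero,
    hρ₃.funInv.idAdd.map_zero, hy.map_zero]

theorem offsetGain_mono (hρ₁ : IsClassKInf ρ₁) (hρ₂ : IsClassKInf ρ₂) (hρ₃ : IsClassKInf ρ₃)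
    (hy : IsClassK γ₁y) {a₁ a₂ b₁ b₂ : ℝ≥0} (h₁ : a₁ ≤ b₁) (h₂ : a₂ ≤ b₂) :
    offsetGain ρ₁ ρ₂ ρ₃ γ₁y a₁ a₂ ≤ offsetGain ρ₁ ρ₂ ρ₃ γ₁y b₁ b₂ :=
  hρ₁.funInv.idAdd.monotone (hρ₃.funInv.idAdd.monotone (add_le_add h₁
    (hy.monotone (hρ₂.funInv.idAdd.monotone (hρ₃.funInv.idAdd.monotone h₂)))))

theorem offsetGain_continuous (hρ₁ : IsClassKInf ρ₁) (hρ₂ : IsClassKInf ρ₂)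
    (hρ₃ : IsClassKInf ρ₃) (hy : IsClassK γ₁y) {b₁ b₂ : ℝ≥0 → ℝ≥0} (h₁ : Continuous b₁)
    (h₂ : Continuous b₂) : Continuous fun s => offsetGain ρ₁ ρ₂ ρ₃ γ₁y (b₁ s) (b₂ s) :=
  hρ₁.funInv.idAdd.continuous.comp (hρ₃.funInv.idAdd.continuous.comp (h₁.add
    (hy.continuous.comp (hρ₂.funInv.idAdd.continuous.comp
      (hρ₃.funInv.idAdd.continuous.comp h₂)))))

/-- Splitting the small-gain bound into the gain of the external input and the offset. -/
theorem small_gain_bound_le (hρ₁ : IsClassKInf ρ₁) (hρ₂ : IsClassKInf ρ₂) (hρ₃ : IsClassKInf ρ₃)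
    (hy : IsClassK γ₁y) (γ₁u γ₂u : ℝ≥0 → ℝ≥0) (U b₁ b₂ : ℝ≥0) :
    idAdd (funInv ρ₁) ((γ₁u U + b₁) + γ₁y (idAdd (funInv ρ₂) (γ₂u U + b₂))) ≤
      loopGain ρ₁ ρ₂ ρ₃ γ₁y γ₁u γ₂u U + offsetGain ρ₁ ρ₂ ρ₃ γ₁y b₁ b₂ := by
  have m1 := hρ₁.funInv.idAdd.monotone
  have m2 := hy.monotone.comp hρ₂.funInv.idAdd.monotone
  have m3 := hρ₃.idAdd.monotone
  have h1 := m2.weak_triangle hρ₃ (γ₂u U) b₂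
  simp only [Function.comp] at h1
  have h2 : idAdd ρ₃ (γ₂u U) ≤ (idAdd ρ₃)^[2] (γ₂u U) := le_idAdd _ _
  have h3 : (γ₁u U + b₁) + γ₁y (idAdd (funInv ρ₂) (γ₂u U + b₂)) ≤
      (γ₁u U + γ₁y (idAdd (funInv ρ₂) ((idAdd ρ₃)^[2] (γ₂u U)))) +
      (b₁ + γ₁y (idAdd (funInv ρ₂) (idAdd (funInv ρ₃) b₂))) := by
    calc _ ≤ (γ₁u U + b₁) + (γ₁y (idAdd (funInv ρ₂) ((idAdd ρ₃)^[2] (γ₂u U))) +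
          γ₁y (idAdd (funInv ρ₂) (idAdd (funInv ρ₃) b₂))) := by
          refine add_le_add le_rfl (h1.trans (add_le_add (m2 h2) le_rfl))
      _ = _ := by ring
  refine (m1 h3).trans ((m1.weak_triangle hρ₃ _ _).trans (add_le_add (m1 ?_) le_rfl))
  exact le_idAdd _ _

end offsetGain

theorem exists_pos_add_le {g : ℝ≥0 → ℝ≥0} (hg : Continuous g) (a : ℝ≥0) {ε : ℝ≥0} (hε : 0 < ε) :
    ∃ δ, 0 < δ ∧ g (a + δ) ≤ g a + ε := by
  have h : ∀ᶠ b in 𝓝 a, g b < g a + ε :=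
    hg.continuousAt.eventually_lt continuousAt_const (by simpa using hε)
  have h' : Tendsto (fun δ : ℝ≥0 => a + δ) (𝓝[>] 0) (𝓝 a) := by
    have : Tendsto (fun δ : ℝ≥0 => a + δ) (𝓝 0) (𝓝 (a + 0)) :=
      (continuous_const.add continuous_id).tendsto 0
    rw [add_zero] at this
    exact this.mono_left nhdsWithin_le_nhds
  obtain ⟨δ, h1, h2⟩ := ((h'.eventually h).and self_mem_nhdsWithin).exists
  exact ⟨δ, h2, h1.le⟩

/-- The small-gain argument for upper bounds.  If `P₁`, `P₂` are the sets of upper bounds (up to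
arbitrarily small errors) of two quantities, the number argument applies to their infima. -/
theorem small_gain_upperBounds {γ₁y γ₂y ρ₁ ρ₂ : ℝ≥0 → ℝ≥0} {sl : ℝ≥0} (hy₁ : IsClassK γ₁y)
    (hy₂ : IsClassK γ₂y) (hρ₁ : IsClassKInf ρ₁) (hρ₂ : IsClassKInf ρ₂)
    (hgain : ∀ s, sl ≤ s → (idAdd ρ₁ ∘ γ₁y ∘ idAdd ρ₂ ∘ γ₂y) s ≤ s) {A₁ A₂ : ℝ≥0}
    {P₁ P₂ : ℝ≥0 → Prop} (m₁ : Monotone P₁) (m₂ : Monotone P₂)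
    (ne₁ : ∃ c, P₁ c) (ne₂ : ∃ c, P₂ c)
    (h₁ : ∀ V δ, 0 < δ → P₂ V → P₁ (A₁ + γ₁y V + δ))
    (h₂ : ∀ V δ, 0 < δ → P₁ V → P₂ (A₂ + γ₂y V + δ)) {ε : ℝ≥0} (hε : 0 < ε) :
    P₁ (sl + idAdd (funInv ρ₁) (A₁ + γ₁y (idAdd (funInv ρ₂) A₂)) + ε) := by
  have near : ∀ {P : ℝ≥0 → Prop}, Monotone P → (∃ c, P c) → ∀ {δ : ℝ≥0}, 0 < δ →
      P (sInf {c | P c} + δ) := by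
    intro P m ne δ hδ
    obtain ⟨c, hc, hlt⟩ := exists_lt_of_csInf_lt (s := {c | P c}) ne (lt_add_of_pos_right _ hδ)
    exact m hlt.le hc
  have step : ∀ {P Q : ℝ≥0 → Prop} {g : ℝ≥0 → ℝ≥0} {A : ℝ≥0}, IsClassK g → Monotone Q →
      (∃ c, Q c) → (∀ V δ, 0 < δ → Q V → P (A + g V + δ)) →
      sInf {c | P c} ≤ A + g (sInf {c | Q c}) := by
    intro P Q g A hg m ne h
    refine le_of_forall_pos_le_add fun η hη => ?_
    obtain ⟨δ, hδ, hle⟩ := exists_pos_add_le hg.continuous (sInf {c | Q c}) (half_pos hη)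
    have := csInf_le (OrderBot.bddBelow {c | P c}) (h _ (η / 2) (half_pos hη) (near m ne hδ))
    refine this.trans ?_
    calc A + g (sInf {c | Q c} + δ) + η / 2 ≤ A + (g (sInf {c | Q c}) + η / 2) + η / 2 := by gcongr
      _ = A + g (sInf {c | Q c}) + η := by
        rw [add_assoc, add_assoc, add_assoc, add_halves]
  have := small_gain_le hy₁ hρ₁ hρ₂ hgain (step hy₁ m₂ ne₂ h₁) (step hy₂ m₁ ne₁ h₂)
  exact m₁ (add_le_add this le_rfl) (near m₁ ne₁ hε)

/-! ### Majorants of class `KL` -/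

section Average

variable {φ : ℝ≥0 → ℝ≥0}

/-- The mean of `φ` over `[s,2s]`, a continuous majorant of a monotone `φ`. -/
def dilationMean (φ : ℝ≥0 → ℝ≥0) (s : ℝ≥0) : ℝ := ∫ r in (1 : ℝ)..2, (φ (s * r).toNNReal : ℝ)

theorem monotone_toNNReal_comp (hφ : Monotone φ) : Monotone fun r : ℝ => (φ r.toNNReal : ℝ) :=
  fun _ _ h => NNReal.coe_le_coe.2 (hφ (Real.toNNReal_mono h))

theorem dilationMean_intervalIntegrable (hφ : Monotone φ) (s : ℝ≥0) :
    IntervalIntegrable (fun r : ℝ => (φ (s * r).toNNReal : ℝ)) volume 1 2 :=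
  Monotone.intervalIntegrable fun _ _ h =>
    monotone_toNNReal_comp hφ (mul_le_mul_of_nonneg_left h s.coe_nonneg)

theorem dilationMean_mono {ψ : ℝ≥0 → ℝ≥0} (hφ : Monotone φ) (hψ : Monotone ψ) {s s' : ℝ≥0}
    (hs : s ≤ s') (h : ∀ r, φ r ≤ ψ r) : dilationMean φ s ≤ dilationMean ψ s' := by
  refine intervalIntegral.integral_mono_on (by norm_num) (dilationMean_intervalIntegrable hφ s)
    (dilationMean_intervalIntegrable hψ s') fun r hr => ?_
  refine NNReal.coe_le_coe.2 ((hφ (Real.toNNReal_mono ?_)).trans (h _))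
  exact mul_le_mul_of_nonneg_right (NNReal.coe_le_coe.2 hs) (by linarith [hr.1])

theorem le_dilationMean (hφ : Monotone φ) (s : ℝ≥0) : (φ s : ℝ) ≤ dilationMean φ s := by
  have : ∫ _ in (1 : ℝ)..2, (φ s : ℝ) ≤ dilationMean φ s := by
    refine intervalIntegral.integral_mono_on (by norm_num) (by simp)
      (dilationMean_intervalIntegrable hφ s) fun r hr => ?_
    refine NNReal.coe_le_coe.2 (hφ ?_)
    rw [← NNReal.coe_le_coe, Real.coe_toNNReal _ (by have := hr.1; positivity)]
    exact le_mul_of_one_le_right s.coe_nonneg hr.1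
  norm_num at this
  exact this

theorem dilationMean_le (hφ : Monotone φ) (s : ℝ≥0) : dilationMean φ s ≤ φ (2 * s) := by
  have : dilationMean φ s ≤ ∫ _ in (1 : ℝ)..2, (φ (2 * s) : ℝ) := by
    refine intervalIntegral.integral_mono_on (by norm_num)
      (dilationMean_intervalIntegrable hφ s) (by simp) fun r hr => ?_
    refine NNReal.coe_le_coe.2 (hφ ?_)
    rw [← NNReal.coe_le_coe, Real.coe_toNNReal _ (by have := hr.1; positivity)]
    push_cast
    rw [mul_comm]
    exact mul_le_mul_of_nonneg_right hr.2 s.coe_nonneg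
  norm_num at this
  exact this

theorem dilationMean_continuous {M : ℝ≥0 → ℝ≥0} (hφ : Monotone φ) (hM : IsClassK M)
    (hφM : ∀ r, φ r ≤ M r) : Continuous (dilationMean φ) := by
  have hnn : ∀ s, 0 ≤ dilationMean φ s := fun s => (φ s).coe_nonneg.trans (le_dilationMean hφ s)
  refine continuous_iff_continuousAt.2 fun s => ?_
  rcases eq_or_ne s 0 with rfl | hs
  · -- at the origin continuity comes from the majorant `M`
    have h0 : dilationMean φ 0 = 0 := by
      refine le_antisymm ((dilationMean_le hφ 0).trans ?_) (hnn 0)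
      have : φ 0 = 0 := le_antisymm ((hφM 0).trans hM.map_zero.le) zero_le
      simp [this]
    rw [ContinuousAt, h0]
    have hM' : Tendsto (fun s : ℝ≥0 => (M (2 * s) : ℝ)) (𝓝 0) (𝓝 0) := by
      have hc : Continuous fun s : ℝ≥0 => (M (2 * s) : ℝ) :=
        NNReal.continuous_coe.comp (hM.continuous.comp (by fun_prop))
      simpa [hM.map_zero] using hc.tendsto 0
    exact squeeze_zero hnn
      (fun s => (dilationMean_le hφ s).trans (NNReal.coe_le_coe.2 (hφM _))) hM'
  · -- away from the origin the mean is a difference quotient of a continuous primitive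
    set F : ℝ → ℝ := fun b => ∫ r in (0 : ℝ)..b, (φ r.toNNReal : ℝ) with hF
    have hint : ∀ a b : ℝ, IntervalIntegrable (fun r : ℝ => (φ r.toNNReal : ℝ)) volume a b :=
      fun a b => (monotone_toNNReal_comp hφ).intervalIntegrable
    have hFc : Continuous F := intervalIntegral.continuous_primitive hint 0
    have hev : (fun s : ℝ≥0 => (s : ℝ)⁻¹ * (F (s * 2) - F (s * 1))) =ᶠ[𝓝 s] dilationMean φ := by
      filter_upwards [isOpen_ne.mem_nhds hs] with r hr
      have hr' : (r : ℝ) ≠ 0 := by exact_mod_cast hr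
      rw [dilationMean, intervalIntegral.integral_comp_mul_left
        (fun x : ℝ => (φ x.toNNReal : ℝ)) hr', smul_eq_mul,
        intervalIntegral.integral_interval_sub_left (hint _ _) (hint _ _)]
    refine ContinuousAt.congr ?_ hev
    have hs' : (s : ℝ) ≠ 0 := by exact_mod_cast hs
    have hc : ContinuousAt (fun s : ℝ≥0 => (s : ℝ)) s := NNReal.continuous_coe.continuousAt
    exact (hc.inv₀ hs').mul (((hFc.comp (by fun_prop)).continuousAt).sub
      ((hFc.comp (by fun_prop)).continuousAt))

end Average

/-- A function that is increasing in its first argument, decreasing to zero in its second (discrete)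
argument, and initially below a function of class `K`, has a majorant of class `KL`. -/
theorem exists_classKL_majorant {φ : ℝ≥0 → ℕ → ℝ≥0} {M : ℝ≥0 → ℝ≥0}
    (hmono : ∀ n, Monotone fun r => φ r n) (hanti : ∀ r, Antitone (φ r))
    (hlim : ∀ r, Tendsto (φ r) atTop (𝓝 0)) (hM : IsClassK M) (hφM : ∀ r, φ r 0 ≤ M r) :
    ∃ β, IsClassKL β ∧ ∀ r t, φ r ⌊t⌋₊ ≤ β r t := by
  have hle : ∀ r n, φ r n ≤ M r := fun r n => (hanti r n.zero_le).trans (hφM r)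
  obtain ⟨ψ, ψc, ψm, ψ0, ψa, ψl, φψ⟩ : ∃ ψ : ℝ≥0 → ℕ → ℝ≥0, (∀ n, Continuous fun s => ψ s n) ∧
      (∀ n, Monotone fun s => ψ s n) ∧ (∀ n, ψ 0 n = 0) ∧ (∀ s, Antitone (ψ s)) ∧
      (∀ s, Tendsto (ψ s) atTop (𝓝 0)) ∧ ∀ s n, φ s n ≤ ψ s n := by
    have hup : ∀ s n, (dilationMean (fun r => φ r n) s).toNNReal ≤ φ (2 * s) n := fun s n =>
      Real.toNNReal_le_iff_le_coe.2 (dilationMean_le (hmono n) s)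
    refine ⟨fun s n => (dilationMean (fun r => φ r n) s).toNNReal, fun n => ?_, fun n a b hab => ?_,
      fun n => ?_, fun s a b hab => ?_, fun s => ?_, fun s n => ?_⟩
    · exact continuous_real_toNNReal.comp (dilationMean_continuous (hmono n) hM fun r => hle r n)
    · exact Real.toNNReal_mono (dilationMean_mono (hmono n) (hmono n) hab fun _ => le_rfl)
    · refine le_antisymm ((hup 0 n).trans ?_) zero_le
      rw [mul_zero]
      exact (hle 0 n).trans hM.map_zero.le
    · exact Real.toNNReal_mono (dilationMean_mono (hmono b) (hmono a) le_rfl fun r => hanti r hab)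
    · exact tendsto_of_tendsto_of_tendsto_of_le_of_le tendsto_const_nhds (hlim (2 * s))
        (fun _ => zero_le) (hup s)
    · exact NNReal.le_toNNReal_of_coe_le (le_dilationMean (hmono n) s)
  have hinv : Antitone fun t : ℝ≥0 => (1 + t)⁻¹ := fun a b hab =>
    inv_anti₀ (by positivity) (add_le_add le_rfl hab)
  have hinv0 : Tendsto (fun t : ℝ≥0 => (1 + t)⁻¹) atTop (𝓝 0) :=
    Tendsto.inv_tendsto_atTop (tendsto_atTop_mono (fun _ => le_add_self) tendsto_id)
  -- the second summand provides strict monotonicity in `s`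
  refine ⟨fun s t => ψ s ⌊t⌋₊ + s * (1 + t)⁻¹, ⟨fun t => ⟨?_, ?_, ?_⟩, ?_, ?_⟩, ?_⟩
  · exact (ψc _).add (continuous_id.mul continuous_const)
  · intro a b hab
    exact add_lt_add_of_le_of_lt (ψm _ hab.le) (mul_lt_mul_of_pos_right hab (by positivity))
  · simp [ψ0]
  · intro s a b hab
    exact add_le_add (ψa s (Nat.floor_mono hab)) (mul_le_mul_right (hinv hab) s)
  · intro s
    have h1 := ((ψl s).comp (tendsto_nat_floor_atTop (α := ℝ≥0))).add (hinv0.const_mul s)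
    rw [mul_zero, add_zero] at h1
    exact h1
  · intro r t
    exact (φψ r _).trans le_self_add

/-! ### Trajectories of a feedback loop, seen through their norms -/

/-- `y ≤ c` almost everywhere on `[a,T)`. -/
def AEBound (y : ℝ → ℝ≥0) (a T : ℝ) (c : ℝ≥0) : Prop := ∀ᵐ t, a ≤ t → t < T → y t ≤ c

theorem AEBound.mono {y : ℝ → ℝ≥0} {a b T : ℝ} {c d : ℝ≥0} (h : AEBound y a T c) (hab : a ≤ b)
    (hcd : c ≤ d) : AEBound y b T d :=
  Filter.Eventually.mono h fun _ ht h1 h2 => (ht (hab.trans h1) h2).trans hcd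

theorem AEBound.of_forall_pos {y : ℝ → ℝ≥0} {a T : ℝ} {c : ℝ≥0}
    (h : ∀ ε, 0 < ε → AEBound y a T (c + ε)) : AEBound y a T c := by
  obtain ⟨u, -, hu, hlim⟩ := exists_seq_strictAnti_tendsto (0 : ℝ≥0)
  filter_upwards [ae_all_iff.2 fun n => h (u n) (hu n)] with t ht h1 h2
  have : Tendsto (fun n => c + u n) atTop (𝓝 (c + 0)) := hlim.const_add c
  rw [add_zero] at this
  exact ge_of_tendsto' this fun n => ht n h1 h2

/-- The comparison functions and constants of the two subsystems of a feedback loop: output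
estimates `(βᵢ, γᵢʸ, γᵢᵘ, dᵢ)` and state estimates `(αᵢ, Dᵢ)`. -/
structure LoopData where
  (β₁ β₂ : ℝ≥0 → ℝ≥0 → ℝ≥0)
  (γ₁y γ₁u γ₂y γ₂u α₁ α₂ : ℝ≥0 → ℝ≥0)
  (d₁ d₂ D₁ D₂ : ℝ≥0)

/-- The functions of `LoopData` are of the classes required in the small-gain theorem. -/
structure LoopData.Regular (L : LoopData) : Prop where
  β₁ : IsClassKL L.β₁
  β₂ : IsClassKL L.β₂
  γ₁y : IsClassK L.γ₁y
  γ₁u : IsClassK L.γ₁u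
  γ₂y : IsClassK L.γ₂y
  γ₂u : IsClassK L.γ₂u
  α₁ : IsClassK L.α₁
  α₂ : IsClassK L.α₂

/-- The loop with the two subsystems exchanged. -/
def LoopData.swap (L : LoopData) : LoopData :=
  ⟨L.β₂, L.β₁, L.γ₂y, L.γ₂u, L.γ₁y, L.γ₁u, L.α₂, L.α₁, L.d₂, L.d₁, L.D₂, L.D₁⟩

theorem LoopData.Regular.swap {L : LoopData} (h : L.Regular) : L.swap.Regular :=
  ⟨h.β₂, h.β₁, h.γ₂y, h.γ₂u, h.γ₁y, h.γ₁u, h.α₂, h.α₁⟩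

/-- The norms of the states and outputs along a trajectory of a feedback loop on `[0,T)` whose
external inputs are bounded by `U`: the outputs are essentially bounded, the output estimates hold
when started at any time `a ∈ [0,T)`, and the state estimates hold. -/
structure LoopTrajectory (L : LoopData) (U : ℝ≥0) (T : ℝ) (x₁ x₂ y₁ y₂ : ℝ → ℝ≥0) : Prop where
  bdd₁ : ∃ c, AEBound y₁ 0 T c
  bdd₂ : ∃ c, AEBound y₂ 0 T c
  output₁ : ∀ a V, 0 ≤ a → a < T → AEBound y₂ a T V →
    ∀ᵐ t, a ≤ t → t < T → y₁ t ≤ L.β₁ (x₁ a) (t - a).toNNReal + L.γ₁y V + L.γ₁u U + L.d₁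
  output₂ : ∀ a V, 0 ≤ a → a < T → AEBound y₁ a T V →
    ∀ᵐ t, a ≤ t → t < T → y₂ t ≤ L.β₂ (x₂ a) (t - a).toNNReal + L.γ₂y V + L.γ₂u U + L.d₂
  state₁ : ∀ V₁ V₂, AEBound y₁ 0 T V₁ → AEBound y₂ 0 T V₂ →
    ∀ t, 0 ≤ t → t < T → x₁ t ≤ L.α₁ (x₁ 0 + (V₁ + V₂ + U)) + L.D₁
  state₂ : ∀ V₁ V₂, AEBound y₁ 0 T V₁ → AEBound y₂ 0 T V₂ →
    ∀ t, 0 ≤ t → t < T → x₂ t ≤ L.α₂ (x₂ 0 + (V₁ + V₂ + U)) + L.D₂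

namespace LoopTrajectory

variable {L : LoopData} {U : ℝ≥0} {T : ℝ} {x₁ x₂ y₁ y₂ : ℝ → ℝ≥0}

theorem swap (h : LoopTrajectory L U T x₁ x₂ y₁ y₂) : LoopTrajectory L.swap U T x₂ x₁ y₂ y₁ where
  bdd₁ := h.bdd₂
  bdd₂ := h.bdd₁
  output₁ := h.output₂
  output₂ := h.output₁
  state₁ V₁ V₂ h₁ h₂ := by rw [add_comm V₁]; exact h.state₂ V₂ V₁ h₂ h₁
  state₂ V₁ V₂ h₁ h₂ := by rw [add_comm V₁]; exact h.state₁ V₂ V₁ h₂ h₁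

/-- The output estimate of the first subsystem after a waiting time `τ`. -/
theorem aeBound_output₁ (hL : L.Regular) (h : LoopTrajectory L U T x₁ x₂ y₁ y₂) {a τ : ℝ}
    {S V W b : ℝ≥0} (ha : 0 ≤ a) (hτ : 0 ≤ τ) (hS : a < T → x₁ a ≤ S) (hV : AEBound y₂ a T V)
    (hU : U ≤ W) (hb : L.β₁ S τ.toNNReal ≤ b) :
    AEBound y₁ (a + τ) T (b + L.γ₁y V + L.γ₁u W + L.d₁) := by
  by_cases haT : a < T
  · filter_upwards [h.output₁ a V ha haT hV] with t ht h1 h2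
    refine (ht (by linarith) h2).trans ?_
    gcongr
    · refine le_trans ?_ hb
      exact ((hL.β₁.classK _).monotone (hS haT)).trans
        (hL.β₁.antitone _ (Real.toNNReal_mono (by linarith)))
    · exact hL.γ₁u.monotone hU
  · exact Eventually.of_forall fun t h1 h2 => absurd (by linarith) haT

theorem aeBound_output₂ (hL : L.Regular) (h : LoopTrajectory L U T x₁ x₂ y₁ y₂) {a τ : ℝ}
    {S V W b : ℝ≥0} (ha : 0 ≤ a) (hτ : 0 ≤ τ) (hS : a < T → x₂ a ≤ S) (hV : AEBound y₁ a T V)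
    (hU : U ≤ W) (hb : L.β₂ S τ.toNNReal ≤ b) :
    AEBound y₂ (a + τ) T (b + L.γ₂y V + L.γ₂u W + L.d₂) :=
  h.swap.aeBound_output₁ hL.swap ha hτ hS hV hU hb

end LoopTrajectory

/-! ### Uniform boundedness and attractivity of the loop -/

/-- The small-gain condition of the loop above the threshold `sl`, with margins `ρ₁`, `ρ₂`; the
function `ρ₃` measures the loss in splitting estimates. -/
structure LoopData.SmallGain (L : LoopData) (ρ₁ ρ₂ ρ₃ : ℝ≥0 → ℝ≥0) (sl : ℝ≥0) : Prop where
  margin₁ : IsClassKInf ρ₁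
  margin₂ : IsClassKInf ρ₂
  margin₃ : IsClassKInf ρ₃
  gain₁ : ∀ s, sl ≤ s → (idAdd ρ₁ ∘ L.γ₁y ∘ idAdd ρ₂ ∘ L.γ₂y) s ≤ s
  gain₂ : ∀ s, sl ≤ s → (idAdd ρ₂ ∘ L.γ₂y ∘ idAdd ρ₁ ∘ L.γ₁y) s ≤ s

theorem LoopData.SmallGain.swap {L : LoopData} {ρ₁ ρ₂ ρ₃ : ℝ≥0 → ℝ≥0} {sl : ℝ≥0}
    (h : L.SmallGain ρ₁ ρ₂ ρ₃ sl) : L.swap.SmallGain ρ₂ ρ₁ ρ₃ sl :=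
  ⟨h.margin₂, h.margin₁, h.margin₃, h.gain₂, h.gain₁⟩

namespace LoopData

variable {L : LoopData} {ρ₁ ρ₂ ρ₃ : ℝ≥0 → ℝ≥0} {sl : ℝ≥0}

/-- The gain from the external inputs to the first output. -/
def gain (L : LoopData) (ρ₁ ρ₂ ρ₃ : ℝ≥0 → ℝ≥0) : ℝ≥0 → ℝ≥0 :=
  loopGain ρ₁ ρ₂ ρ₃ L.γ₁y L.γ₁u L.γ₂u

theorem Regular.gain (hL : L.Regular) (hG : L.SmallGain ρ₁ ρ₂ ρ₃ sl) :
    IsClassK (L.gain ρ₁ ρ₂ ρ₃) :=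
  isClassK_loopGain hG.margin₁ hG.margin₂ hG.margin₃ hL.γ₁y hL.γ₁u hL.γ₂u

/-- The part of the bound on the first output caused by initial states of norm at most `r`. -/
def initialGain (L : LoopData) (ρ₁ ρ₂ ρ₃ : ℝ≥0 → ℝ≥0) (r : ℝ≥0) : ℝ≥0 :=
  offsetGain ρ₁ ρ₂ ρ₃ L.γ₁y (L.β₁ r 0 + L.d₁) (L.β₂ r 0 + L.d₂)

theorem initialGain_mono (hL : L.Regular) (hG : L.SmallGain ρ₁ ρ₂ ρ₃ sl) :
    Monotone (L.initialGain ρ₁ ρ₂ ρ₃) := fun _ _ h =>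
  offsetGain_mono hG.margin₁ hG.margin₂ hG.margin₃ hL.γ₁y
    (add_le_add ((hL.β₁.classK 0).monotone h) le_rfl)
    (add_le_add ((hL.β₂.classK 0).monotone h) le_rfl)

theorem initialGain_continuous (hL : L.Regular) (hG : L.SmallGain ρ₁ ρ₂ ρ₃ sl) :
    Continuous (L.initialGain ρ₁ ρ₂ ρ₃) :=
  offsetGain_continuous hG.margin₁ hG.margin₂ hG.margin₃ hL.γ₁y
    ((hL.β₁.classK 0).continuous.add continuous_const)
    ((hL.β₂.classK 0).continuous.add continuous_const)

/-- The ultimate offset of the first output, vanishing when `sl` and both `dᵢ` vanish. -/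
def offset (L : LoopData) (ρ₁ ρ₂ ρ₃ : ℝ≥0 → ℝ≥0) (sl : ℝ≥0) : ℝ≥0 :=
  sl + offsetGain ρ₁ ρ₂ ρ₃ L.γ₁y L.d₁ L.d₂

theorem initialGain_zero (hL : L.Regular) :
    L.initialGain ρ₁ ρ₂ ρ₃ 0 = offsetGain ρ₁ ρ₂ ρ₃ L.γ₁y L.d₁ L.d₂ := by
  simp [initialGain, (hL.β₁.classK 0).map_zero, (hL.β₂.classK 0).map_zero]

/-- A class `K` bound for the increase of `initialGain` over its value at `0`. -/
def transient (L : LoopData) (ρ₁ ρ₂ ρ₃ : ℝ≥0 → ℝ≥0) (r : ℝ≥0) : ℝ≥0 :=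
  (L.initialGain ρ₁ ρ₂ ρ₃ r - L.initialGain ρ₁ ρ₂ ρ₃ 0) + r

theorem isClassK_transient (hL : L.Regular) (hG : L.SmallGain ρ₁ ρ₂ ρ₃ sl) :
    IsClassK (L.transient ρ₁ ρ₂ ρ₃) :=
  ⟨((initialGain_continuous hL hG).sub continuous_const).add continuous_id,
    fun _ _ h => add_lt_add_of_le_of_lt (tsub_le_tsub_right (initialGain_mono hL hG h.le) _) h,
    by simp [transient]⟩

theorem initialGain_le (hL : L.Regular) (r : ℝ≥0) :
    sl + L.initialGain ρ₁ ρ₂ ρ₃ r ≤ L.transient ρ₁ ρ₂ ρ₃ r + L.offset ρ₁ ρ₂ ρ₃ sl := by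
  have h : L.initialGain ρ₁ ρ₂ ρ₃ r ≤
      (L.initialGain ρ₁ ρ₂ ρ₃ r - L.initialGain ρ₁ ρ₂ ρ₃ 0) + L.initialGain ρ₁ ρ₂ ρ₃ 0 :=
    le_tsub_add
  rw [transient, offset, ← initialGain_zero (ρ₁ := ρ₁) (ρ₂ := ρ₂) (ρ₃ := ρ₃) hL]
  calc _ ≤ sl + ((L.initialGain ρ₁ ρ₂ ρ₃ r - L.initialGain ρ₁ ρ₂ ρ₃ 0) +
        L.initialGain ρ₁ ρ₂ ρ₃ 0) := add_le_add le_rfl h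
    _ ≤ sl + ((L.initialGain ρ₁ ρ₂ ρ₃ r - L.initialGain ρ₁ ρ₂ ρ₃ 0) +
        L.initialGain ρ₁ ρ₂ ρ₃ 0) + r := le_self_add
    _ = _ := by ring

/-- Uniform boundedness: the output is bounded by its gain, a transient depending on the initial
states only, and the offset. -/
theorem aeBound_transient (hL : L.Regular) (hG : L.SmallGain ρ₁ ρ₂ ρ₃ sl) {U r : ℝ≥0} {T : ℝ}
    {x₁ x₂ y₁ y₂ : ℝ → ℝ≥0} (h : LoopTrajectory L U T x₁ x₂ y₁ y₂) (h₁ : x₁ 0 ≤ r)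
    (h₂ : x₂ 0 ≤ r) :
    AEBound y₁ 0 T
      (L.gain ρ₁ ρ₂ ρ₃ U + L.transient ρ₁ ρ₂ ρ₃ r + L.offset ρ₁ ρ₂ ρ₃ sl) := by
  refine AEBound.of_forall_pos fun ε hε => ?_
  have key := small_gain_upperBounds (P₁ := AEBound y₁ 0 T) (P₂ := AEBound y₂ 0 T)
    (A₁ := L.γ₁u U + (L.β₁ r 0 + L.d₁)) (A₂ := L.γ₂u U + (L.β₂ r 0 + L.d₂)) hL.γ₁y hL.γ₂y
    hG.margin₁ hG.margin₂ hG.gain₁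
    (fun _ _ hab h => h.mono le_rfl hab) (fun _ _ hab h => h.mono le_rfl hab) h.bdd₁ h.bdd₂
    (fun V δ _ hV => ?_) (fun V δ _ hV => ?_) hε
  · refine key.mono le_rfl (add_le_add ?_ le_rfl)
    calc _ ≤ sl + (L.gain ρ₁ ρ₂ ρ₃ U + L.initialGain ρ₁ ρ₂ ρ₃ r) :=
          add_le_add le_rfl (small_gain_bound_le hG.margin₁ hG.margin₂ hG.margin₃ hL.γ₁y _ _ _ _ _)
      _ = L.gain ρ₁ ρ₂ ρ₃ U + (sl + L.initialGain ρ₁ ρ₂ ρ₃ r) := by ring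
      _ ≤ L.gain ρ₁ ρ₂ ρ₃ U + (L.transient ρ₁ ρ₂ ρ₃ r + L.offset ρ₁ ρ₂ ρ₃ sl) :=
          add_le_add le_rfl (initialGain_le hL r)
      _ = _ := by ring
  · refine (h.aeBound_output₁ hL le_rfl le_rfl (fun _ => h₁) hV le_rfl le_rfl).mono (by simp) ?_
    rw [Real.toNNReal_zero]
    calc _ = L.γ₁u U + (L.β₁ r 0 + L.d₁) + L.γ₁y V := by ring
      _ ≤ _ := le_self_add
  · refine (h.aeBound_output₂ hL le_rfl le_rfl (fun _ => h₂) hV le_rfl le_rfl).mono (by simp) ?_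
    rw [Real.toNNReal_zero]
    calc _ = L.γ₂u U + (L.β₂ r 0 + L.d₂) + L.γ₂y V := by ring
      _ ≤ _ := le_self_add

/-- `c` is, from time `n` on, an upper bound of `y₁ - g(U)` along all trajectories with initial
states bounded by `r` and external inputs bounded by some `U ∈ K`. -/
def UniformBound (L : LoopData) (g : ℝ≥0 → ℝ≥0) (K : Set ℝ≥0) (r : ℝ≥0) (n : ℕ) (c : ℝ≥0) : Prop :=
  ∀ ⦃U T x₁ x₂ y₁ y₂⦄, LoopTrajectory L U T x₁ x₂ y₁ y₂ → U ∈ K → x₁ 0 ≤ r → x₂ 0 ≤ r →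
    AEBound y₁ n T (g U + c)

theorem UniformBound.mono {g : ℝ≥0 → ℝ≥0} {K K' : Set ℝ≥0} {r r' : ℝ≥0} {n n' : ℕ} {c c' : ℝ≥0}
    (h : L.UniformBound g K r n c) (hK : K' ⊆ K) (hr : r' ≤ r) (hn : n ≤ n') (hc : c ≤ c') :
    L.UniformBound g K' r' n' c' := fun _ _ _ _ _ _ ht hU h₁ h₂ =>
  (h ht (hK hU) (h₁.trans hr) (h₂.trans hr)).mono (Nat.cast_le.2 hn) (add_le_add le_rfl hc)

/-- Initial states and external inputs in bounded sets lead to uniformly bounded outputs and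
states. -/
theorem exists_uniform_bounds (hL : L.Regular) (hG : L.SmallGain ρ₁ ρ₂ ρ₃ sl) (W r : ℝ≥0) :
    ∃ S : ℝ≥0, ∀ ⦃U T x₁ x₂ y₁ y₂⦄, LoopTrajectory L U T x₁ x₂ y₁ y₂ → U ≤ W → x₁ 0 ≤ r →
      x₂ 0 ≤ r → AEBound y₁ 0 T S ∧ AEBound y₂ 0 T S ∧
        ∀ t, 0 ≤ t → t < T → x₁ t ≤ S ∧ x₂ t ≤ S := by
  set V₁ := L.gain ρ₁ ρ₂ ρ₃ W + L.transient ρ₁ ρ₂ ρ₃ r + L.offset ρ₁ ρ₂ ρ₃ sl with hV₁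
  set V₂ := L.swap.gain ρ₂ ρ₁ ρ₃ W + L.swap.transient ρ₂ ρ₁ ρ₃ r + L.swap.offset ρ₂ ρ₁ ρ₃ sl
    with hV₂
  set S₁ := L.α₁ (r + (V₁ + V₂ + W)) + L.D₁ with hS₁
  set S₂ := L.α₂ (r + (V₁ + V₂ + W)) + L.D₂ with hS₂
  have e₁ : V₁ ≤ V₁ + V₂ + (S₁ + S₂) := by rw [add_assoc]; exact le_self_add
  have e₂ : V₂ ≤ V₁ + V₂ + (S₁ + S₂) := le_add_right le_add_self
  have e₃ : S₁ ≤ V₁ + V₂ + (S₁ + S₂) := le_add_left le_self_add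
  have e₄ : S₂ ≤ V₁ + V₂ + (S₁ + S₂) := le_add_left le_add_self
  refine ⟨V₁ + V₂ + (S₁ + S₂), fun U T x₁ x₂ y₁ y₂ ht hU h₁ h₂ => ?_⟩
  have b₁ : AEBound y₁ 0 T V₁ := (aeBound_transient hL hG ht h₁ h₂).mono le_rfl
    (add_le_add (add_le_add ((hL.gain hG).monotone hU) le_rfl) le_rfl)
  have b₂ : AEBound y₂ 0 T V₂ := (aeBound_transient hL.swap hG.swap ht.swap h₂ h₁).mono le_rfl
    (add_le_add (add_le_add ((hL.swap.gain hG.swap).monotone hU) le_rfl) le_rfl)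
  refine ⟨b₁.mono le_rfl e₁, b₂.mono le_rfl e₂, fun t ht0 htT => ⟨?_, ?_⟩⟩
  · refine ((ht.state₁ V₁ V₂ b₁ b₂ t ht0 htT).trans (add_le_add ?_ le_rfl)).trans e₃
    exact hL.α₁.monotone (by gcongr)
  · refine ((ht.state₂ V₁ V₂ b₁ b₂ t ht0 htT).trans (add_le_add ?_ le_rfl)).trans e₄
    exact hL.α₂.monotone (by gcongr)

theorem _root_.IsClassKL.exists_nat_le {β : ℝ≥0 → ℝ≥0 → ℝ≥0} (hβ : IsClassKL β) (S : ℝ≥0)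
    {δ : ℝ≥0} (hδ : 0 < δ) : ∃ m : ℕ, β S (m : ℝ).toNNReal ≤ δ := by
  have h := ((hβ.tendsto_zero S).comp tendsto_natCast_atTop_atTop).eventually_le_const hδ
  obtain ⟨m, hm⟩ := h.exists
  exact ⟨m, by simpa using hm⟩

/-- Uniform attractivity for external inputs bounded by `W`: since the output estimates can be
restarted at any time, the number argument applies to the infima of the bounds that hold eventually
and uniformly over the trajectories. -/
theorem exists_aeBound_eventually (hL : L.Regular) (hG : L.SmallGain ρ₁ ρ₂ ρ₃ sl) (W r : ℝ≥0)
    {ε : ℝ≥0} (hε : 0 < ε) :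
    ∃ n : ℕ, ∀ ⦃U T x₁ x₂ y₁ y₂⦄, LoopTrajectory L U T x₁ x₂ y₁ y₂ → U ≤ W → x₁ 0 ≤ r →
      x₂ 0 ≤ r → AEBound y₁ n T (L.gain ρ₁ ρ₂ ρ₃ W + L.offset ρ₁ ρ₂ ρ₃ sl + ε) := by
  obtain ⟨S, hS⟩ := exists_uniform_bounds hL hG W r
  have key := small_gain_upperBounds
    (P₁ := fun c => ∃ n : ℕ, ∀ ⦃U T x₁ x₂ y₁ y₂⦄, LoopTrajectory L U T x₁ x₂ y₁ y₂ → U ≤ W →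
      x₁ 0 ≤ r → x₂ 0 ≤ r → AEBound y₁ n T c)
    (P₂ := fun c => ∃ n : ℕ, ∀ ⦃U T x₁ x₂ y₁ y₂⦄, LoopTrajectory L U T x₁ x₂ y₁ y₂ → U ≤ W →
      x₁ 0 ≤ r → x₂ 0 ≤ r → AEBound y₂ n T c)
    (A₁ := L.γ₁u W + L.d₁) (A₂ := L.γ₂u W + L.d₂) hL.γ₁y hL.γ₂y hG.margin₁ hG.margin₂ hG.gain₁
    (fun _ _ hab ⟨n, h⟩ => ⟨n, fun _ _ _ _ _ _ ht hU h₁ h₂ => (h ht hU h₁ h₂).mono le_rfl hab⟩)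
    (fun _ _ hab ⟨n, h⟩ => ⟨n, fun _ _ _ _ _ _ ht hU h₁ h₂ => (h ht hU h₁ h₂).mono le_rfl hab⟩)
    ⟨S, 0, fun _ _ _ _ _ _ ht hU h₁ h₂ => by simpa using (hS ht hU h₁ h₂).1⟩
    ⟨S, 0, fun _ _ _ _ _ _ ht hU h₁ h₂ => by simpa using (hS ht hU h₁ h₂).2.1⟩
    (fun V δ hδ hV => ?_) (fun V δ hδ hV => ?_) hε
  · obtain ⟨n, hn⟩ := key
    refine ⟨n, fun U T x₁ x₂ y₁ y₂ ht hU h₁ h₂ => (hn ht hU h₁ h₂).mono le_rfl ?_⟩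
    refine add_le_add ?_ le_rfl
    calc _ ≤ sl + (L.gain ρ₁ ρ₂ ρ₃ W + offsetGain ρ₁ ρ₂ ρ₃ L.γ₁y L.d₁ L.d₂) :=
          add_le_add le_rfl (small_gain_bound_le hG.margin₁ hG.margin₂ hG.margin₃ hL.γ₁y _ _ _ _ _)
      _ = _ := by rw [offset]; ring
  · obtain ⟨n, hn⟩ := hV
    obtain ⟨m, hm⟩ := hL.β₁.exists_nat_le S hδ
    refine ⟨n + m, fun U T x₁ x₂ y₁ y₂ ht hU h₁ h₂ => ?_⟩
    refine (ht.aeBound_output₁ hL n.cast_nonneg m.cast_nonneg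
      (fun hT => ((hS ht hU h₁ h₂).2.2 n n.cast_nonneg hT).1) (hn ht hU h₁ h₂) hU hm).mono
      (by simp) (le_of_eq (by ring))
  · obtain ⟨n, hn⟩ := hV
    obtain ⟨m, hm⟩ := hL.β₂.exists_nat_le S hδ
    refine ⟨n + m, fun U T x₁ x₂ y₁ y₂ ht hU h₁ h₂ => ?_⟩
    refine (ht.aeBound_output₂ hL n.cast_nonneg m.cast_nonneg
      (fun hT => ((hS ht hU h₁ h₂).2.2 n n.cast_nonneg hT).2) (hn ht hU h₁ h₂) hU hm).mono
      (by simp) (le_of_eq (by ring))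

/-- Uniform attractivity with the gain evaluated at the actual bound `U` of the external inputs, for
`U` in a bounded interval; the waiting time is uniform by compactness. -/
theorem exists_uniformBound_Icc (hL : L.Regular) (hG : L.SmallGain ρ₁ ρ₂ ρ₃ sl) (W r : ℝ≥0)
    {ε : ℝ≥0} (hε : 0 < ε) :
    ∃ n : ℕ, L.UniformBound (fun U => L.gain ρ₁ ρ₂ ρ₃ U + L.offset ρ₁ ρ₂ ρ₃ sl)
      (Set.Icc 0 W) r n ε := by
  set g := L.gain ρ₁ ρ₂ ρ₃ with hg
  have hgK : IsClassK g := hL.gain hG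
  have hε3 : 0 < ε / 3 := by positivity
  refine isCompact_Icc.induction_on (p := fun K => ∃ n : ℕ, L.UniformBound _ K r n ε)
    ⟨0, fun _ _ _ _ _ _ _ h => absurd h (Set.notMem_empty _)⟩
    (fun K K' hK ⟨n, hn⟩ => ⟨n, hn.mono hK le_rfl le_rfl le_rfl⟩) ?_ ?_
  · rintro K K' ⟨n, hn⟩ ⟨n', hn'⟩
    refine ⟨max n n', fun U T x₁ x₂ y₁ y₂ ht hU h₁ h₂ => ?_⟩
    rcases hU with hU | hU
    · exact (hn.mono le_rfl le_rfl (le_max_left _ _) le_rfl) ht hU h₁ h₂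
    · exact (hn'.mono le_rfl le_rfl (le_max_right _ _) le_rfl) ht hU h₁ h₂
  · intro U₀ _
    obtain ⟨δ, hδ, hle⟩ := exists_pos_add_le hgK.continuous U₀ hε3
    obtain ⟨n, hn⟩ := exists_aeBound_eventually hL hG (U₀ + δ) r hε3
    have hev : ∀ᶠ U in 𝓝 U₀, U < U₀ + δ ∧ g U₀ < g U + ε / 3 :=
      (eventually_lt_nhds (lt_add_of_pos_right _ hδ)).and
        (continuousAt_const.eventually_lt (hgK.continuous.continuousAt.add continuousAt_const)
          (lt_add_of_pos_right _ hε3))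
    refine ⟨_, mem_nhdsWithin_of_mem_nhds hev, n, fun U T x₁ x₂ y₁ y₂ ht hU h₁ h₂ => ?_⟩
    refine (hn ht hU.1.le h₁ h₂).mono le_rfl ?_
    calc g (U₀ + δ) + L.offset ρ₁ ρ₂ ρ₃ sl + ε / 3
        ≤ ((g U + ε / 3) + ε / 3) + L.offset ρ₁ ρ₂ ρ₃ sl + ε / 3 := by
          gcongr
          exact hle.trans (add_le_add hU.2.le le_rfl)
      _ = g U + L.offset ρ₁ ρ₂ ρ₃ sl + (ε / 3 + ε / 3 + ε / 3) := by ring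
      _ = _ := by rw [add_thirds]

/-- The output estimate for the loop.  Trajectories whose external inputs are so large that
`r₃₁ U` exceeds the transient satisfy it by boundedness; the remaining inputs form a bounded set, on
which the attractivity is uniform. -/
theorem exists_classKL_bound (hL : L.Regular) (hG : L.SmallGain ρ₁ ρ₂ ρ₃ sl) {r₃₁ : ℝ≥0 → ℝ≥0}
    (hr : IsClassKInf r₃₁) :
    ∃ β, IsClassKL β ∧ ∀ ⦃U T x₁ x₂ y₁ y₂ r⦄, LoopTrajectory L U T x₁ x₂ y₁ y₂ → x₁ 0 ≤ r →
      x₂ 0 ≤ r → ∀ᵐ t, 0 ≤ t → t < T →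
        y₁ t ≤ β r t.toNNReal + (L.gain ρ₁ ρ₂ ρ₃ U + r₃₁ U) + L.offset ρ₁ ρ₂ ρ₃ sl := by
  set g : ℝ≥0 → ℝ≥0 := fun U => L.gain ρ₁ ρ₂ ρ₃ U + r₃₁ U + L.offset ρ₁ ρ₂ ρ₃ sl with hg
  set M := L.transient ρ₁ ρ₂ ρ₃ with hM
  have hMK : IsClassK M := isClassK_transient hL hG
  have h0 : ∀ r, L.UniformBound g Set.univ r 0 (M r) := by
    intro r U T x₁ x₂ y₁ y₂ ht _ h₁ h₂
    refine (aeBound_transient hL hG ht h₁ h₂).mono (by simp) ?_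
    calc _ ≤ L.gain ρ₁ ρ₂ ρ₃ U + M r + L.offset ρ₁ ρ₂ ρ₃ sl + r₃₁ U := le_self_add
      _ = _ := by rw [hg]; ring
  have hlim : ∀ r ε, 0 < ε → ∃ n, L.UniformBound g Set.univ r n ε := by
    intro r ε hε
    obtain ⟨n, hn⟩ := exists_uniformBound_Icc hL hG (funInv r₃₁ (M r)) r hε
    refine ⟨n, fun U T x₁ x₂ y₁ y₂ ht _ h₁ h₂ => ?_⟩
    rcases le_total (M r) (r₃₁ U) with h | h
    · refine (aeBound_transient hL hG ht h₁ h₂).mono n.cast_nonneg ?_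
      calc _ ≤ L.gain ρ₁ ρ₂ ρ₃ U + r₃₁ U + L.offset ρ₁ ρ₂ ρ₃ sl := by gcongr
        _ ≤ _ := le_self_add
    · have hU : U ≤ funInv r₃₁ (M r) := by
        have := hr.funInv.monotone h
        rwa [hr.funInv_apply] at this
      refine (hn ht ⟨zero_le, hU⟩ h₁ h₂).mono le_rfl ?_
      exact add_le_add (add_le_add le_self_add le_rfl) le_rfl
  -- only integer times enter, so that the null sets can be united
  set φ : ℝ≥0 → ℕ → ℝ≥0 := fun r n => sInf {c | L.UniformBound g Set.univ r n c} with hφ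
  have hne : ∀ r n, {c | L.UniformBound g Set.univ r n c}.Nonempty := fun r n =>
    ⟨M r, (h0 r).mono le_rfl le_rfl n.zero_le le_rfl⟩
  have hφ_le : ∀ {r n c}, L.UniformBound g Set.univ r n c → φ r n ≤ c := fun h =>
    csInf_le (OrderBot.bddBelow _) h
  have hφ_mem : ∀ r n, L.UniformBound g Set.univ r n (φ r n) := by
    intro r n U T x₁ x₂ y₁ y₂ ht hU h₁ h₂
    refine AEBound.of_forall_pos fun ε hε => ?_
    obtain ⟨c, hc, hlt⟩ := exists_lt_of_csInf_lt (hne r n) (lt_add_of_pos_right (φ r n) hε)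
    refine (hc ht hU h₁ h₂).mono le_rfl ?_
    exact (add_le_add le_rfl hlt.le).trans_eq (add_assoc _ _ _).symm
  obtain ⟨β, hβ, hφβ⟩ := exists_classKL_majorant (φ := φ) (M := M)
    (fun n r r' h => hφ_le ((hφ_mem r' n).mono le_rfl h le_rfl le_rfl))
    (fun r n n' h => hφ_le ((hφ_mem r n).mono le_rfl le_rfl h le_rfl))
    (fun r => by
      refine tendsto_order.2 ⟨fun a ha => absurd ha not_lt_zero, fun a ha => ?_⟩
      obtain ⟨n, hn⟩ := hlim r (a / 2) (half_pos ha)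
      filter_upwards [eventually_ge_atTop n] with m hm
      exact (hφ_le (hn.mono le_rfl le_rfl hm le_rfl)).trans_lt (half_lt_self ha))
    hMK (fun r => hφ_le (h0 r))
  refine ⟨β, hβ, fun U T x₁ x₂ y₁ y₂ r ht h₁ h₂ => ?_⟩
  filter_upwards [ae_all_iff.2 fun n => hφ_mem r n ht (Set.mem_univ U) h₁ h₂] with t h ht0 htT
  have hfl : ((⌊t.toNNReal⌋₊ : ℕ) : ℝ) ≤ t := by
    have := Nat.floor_le (zero_le : 0 ≤ t.toNNReal)
    have h' := NNReal.coe_le_coe.2 this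
    rwa [Real.coe_toNNReal _ ht0, NNReal.coe_natCast] at h'
  refine (h _ hfl htT).trans ?_
  calc _ ≤ g U + β r t.toNNReal := add_le_add le_rfl (hφβ _ _)
    _ = _ := by rw [hg]; ring

end LoopData

/-! ### Signals -/

theorem timeInterval_coe (T : ℝ) : timeInterval T = Set.Ico 0 T := by
  ext t; simp [timeInterval]

theorem timeInterval_top : timeInterval ⊤ = Set.Ici 0 := by
  ext t; simp [timeInterval]

theorem timeInterval_mono {T T' : EReal} (h : T ≤ T') : timeInterval T ⊆ timeInterval T' :=
  fun _ ht => ⟨ht.1, ht.2.trans_le h⟩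

theorem measurableSet_timeInterval (T : EReal) : MeasurableSet (timeInterval T) :=
  measurableSet_Ici.inter (measurable_coe_real_ereal measurableSet_Iio)

theorem uIoc_subset_timeInterval {T : EReal} {t : ℝ} (ht : t ∈ timeInterval T) :
    Set.uIoc 0 t ⊆ timeInterval T := by
  intro s hs
  rw [Set.uIoc_of_le ht.1] at hs
  exact ⟨hs.1.le, (EReal.coe_le_coe_iff.2 hs.2).trans_lt ht.2⟩

theorem zero_mem_timeInterval {T : EReal} {t : ℝ} (ht : t ∈ timeInterval T) :
    (0 : ℝ) ∈ timeInterval T :=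
  ⟨le_rfl, (EReal.coe_le_coe_iff.2 ht.1).trans_lt ht.2⟩

section Signals

variable {E F : Type*} [NormedAddCommGroup E] [NormedAddCommGroup F]

theorem essNorm_le {u : ℝ → E} {c : ℝ≥0} (h : ∀ᵐ t, 0 ≤ t → ‖u t‖₊ ≤ c) : essNorm u ≤ c := by
  have h' : eLpNorm u ⊤ (volume.restrict (Set.Ici 0)) ≤ c := by
    rw [eLpNorm_exponent_top]
    exact eLpNormEssSup_le_of_ae_nnnorm_bound ((ae_restrict_iff' measurableSet_Ici).2 h)
  have := ENNReal.toNNReal_mono ENNReal.coe_ne_top h'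
  rwa [ENNReal.toNNReal_coe] at this

theorem essNorm_truncate_le {u : ℝ → E} {c : ℝ≥0} {t : ℝ}
    (h : ∀ᵐ s, 0 ≤ s → s ≤ t → ‖u s‖₊ ≤ c) : essNorm (truncate u t) ≤ c := by
  refine essNorm_le ?_
  filter_upwards [h] with s hs h0
  by_cases hst : s ≤ t
  · rw [truncate, Set.indicator_of_mem (show s ∈ Set.Icc 0 t from ⟨h0, hst⟩)]
    exact hs h0 hst
  · rw [truncate, Set.indicator_of_notMem (fun h => hst h.2)]
    simp

theorem ae_le_essNorm {u : ℝ → E} (h : eLpNorm u ⊤ (volume.restrict (Set.Ici 0)) ≠ ⊤) :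
    ∀ᵐ t, 0 ≤ t → ‖u t‖₊ ≤ essNorm u := by
  have := ae_le_eLpNormEssSup (f := u) (μ := volume.restrict (Set.Ici (0 : ℝ)))
  rw [ae_restrict_iff' measurableSet_Ici] at this
  filter_upwards [this] with t ht h0
  have h1 := ht h0
  rw [← eLpNorm_exponent_top] at h1
  exact (ENNReal.le_toNNReal_of_coe_le h1 h)

theorem ae_le_essNorm_truncate {u : ℝ → E} {c : ℝ≥0} {t : ℝ}
    (h : ∀ᵐ s, 0 ≤ s → s ≤ t → ‖u s‖₊ ≤ c) :
    ∀ᵐ s, 0 ≤ s → s ≤ t → ‖u s‖₊ ≤ essNorm (truncate u t) := by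
  have hb : eLpNorm (truncate u t) ⊤ (volume.restrict (Set.Ici 0)) ≠ ⊤ := by
    rw [eLpNorm_exponent_top]
    refine ne_top_of_le_ne_top (ENNReal.coe_ne_top (r := c))
      (eLpNormEssSup_le_of_ae_nnnorm_bound (ae_restrict_of_ae ?_))
    filter_upwards [h] with s hs
    by_cases hst : s ∈ Set.Icc 0 t
    · rw [truncate, Set.indicator_of_mem hst]
      exact hs hst.1 hst.2
    · rw [truncate, Set.indicator_of_notMem hst]
      simp
  filter_upwards [ae_le_essNorm hb] with s hs h0 hst
  have := hs h0
  rwa [truncate, Set.indicator_of_mem (show s ∈ Set.Icc 0 t from ⟨h0, hst⟩)] at this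

theorem isControl_of_bound {u : ℝ → E} {T : EReal} {c : ℝ≥0}
    (hm : AEStronglyMeasurable u (volume.restrict (timeInterval T)))
    (h : ∀ᵐ t, t ∈ timeInterval T → ‖u t‖₊ ≤ c) : IsControl u T :=
  memLp_top_of_bound hm c ((ae_restrict_iff' (measurableSet_timeInterval T)).2 h)

theorem IsControl.exists_bound {u : ℝ → E} {T : EReal} (h : IsControl u T) :
    ∃ c : ℝ≥0, ∀ᵐ t, t ∈ timeInterval T → ‖u t‖₊ ≤ c := by
  refine ⟨(eLpNormEssSup u (volume.restrict (timeInterval T))).toNNReal, ?_⟩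
  have h1 := h.2.ne
  rw [eLpNorm_exponent_top] at h1
  have := ae_le_eLpNormEssSup (f := u) (μ := volume.restrict (timeInterval T))
  rw [ae_restrict_iff' (measurableSet_timeInterval T)] at this
  filter_upwards [this] with t ht h0
  exact ENNReal.le_toNNReal_of_coe_le (ht h0) h1

theorem IsControl.exists_aeBound {u : ℝ → E} {T : ℝ} (h : IsControl u T) :
    ∃ c, AEBound (fun t => ‖u t‖₊) 0 T c := by
  obtain ⟨c, hc⟩ := h.exists_bound
  rw [timeInterval_coe] at hc
  exact ⟨c, hc.mono fun s hs h0 h1 => hs ⟨h0, h1⟩⟩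

theorem IsControl.mono {u : ℝ → E} {T T' : EReal} (h : IsControl u T) (hT : T' ≤ T) :
    IsControl u T' :=
  h.mono_measure (Measure.restrict_mono (timeInterval_mono hT) le_rfl)

theorem nnnorm_toLp_le {p : ℝ≥0∞} [Fact (1 ≤ p)] (a : E) (b : F) :
    ‖WithLp.toLp p (a, b)‖₊ ≤ ‖a‖₊ + ‖b‖₊ := by
  have : WithLp.toLp p (a, b) = WithLp.toLp p (a, (0 : F)) + WithLp.toLp p ((0 : E), b) := by
    rw [← WithLp.toLp_add]; simp
  rw [this]
  refine (nnnorm_add_le _ _).trans ?_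
  rw [WithLp.nnnorm_toLp_inl, WithLp.nnnorm_toLp_inr]

theorem IsControl.toLp {p : ℝ≥0∞} [Fact (1 ≤ p)] {u : ℝ → E} {v : ℝ → F} {T : EReal}
    (hu : IsControl u T) (hv : IsControl v T) :
    IsControl (fun t => WithLp.toLp p (u t, v t)) T := by
  obtain ⟨c, hc⟩ := hu.exists_bound
  obtain ⟨d, hd⟩ := hv.exists_bound
  refine isControl_of_bound (c := c + d)
    ((WithLp.prod_continuous_toLp p E F).comp_aestronglyMeasurable (hu.1.prodMk hv.1)) ?_
  filter_upwards [hc, hd] with t h₁ h₂ ht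
  exact (nnnorm_toLp_le _ _).trans (add_le_add (h₁ ht) (h₂ ht))

theorem IsControl.fst {p : ℝ≥0∞} [Fact (1 ≤ p)] {u : ℝ → WithLp p (E × F)} {T : EReal}
    (hu : IsControl u T) : IsControl (fun t => (u t).fst) T :=
  let ⟨_, hc⟩ := hu.exists_bound
  isControl_of_bound ((WithLp.continuous_fst p E F).comp_aestronglyMeasurable hu.1)
    (hc.mono fun _ h ht => (WithLp.nnnorm_fst_le _ _).trans (h ht))

theorem IsControl.snd {p : ℝ≥0∞} [Fact (1 ≤ p)] {u : ℝ → WithLp p (E × F)} {T : EReal}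
    (hu : IsControl u T) : IsControl (fun t => (u t).snd) T :=
  let ⟨_, hc⟩ := hu.exists_bound
  isControl_of_bound ((WithLp.continuous_snd p E F).comp_aestronglyMeasurable hu.1)
    (hc.mono fun _ h ht => (WithLp.nnnorm_snd_le _ _).trans (h ht))

end Signals

theorem ae_shift {P : ℝ → Prop} (h : ∀ᵐ t, P t) (a : ℝ) : ∀ᵐ s, P (a + s) :=
  (measurePreserving_add_left volume a).quasiMeasurePreserving.ae h

/-! ### Solutions -/

namespace IsSolution

variable {X U : Type*} [NormedAddCommGroup X] [NormedSpace ℝ X] {f : X → U → X} {u u' : ℝ → U}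
  {x x' : ℝ → X} {T T' : EReal}

theorem congr (h : IsSolution f u x T) (hu : Set.EqOn u' u (timeInterval T))
    (hx : Set.EqOn x' x (timeInterval T)) : IsSolution f u' x' T := by
  have hf : ∀ {t}, t ∈ timeInterval T →
      Set.EqOn (fun s => f (x s) (u s)) (fun s => f (x' s) (u' s)) (Set.uIoc 0 t) := by
    intro t ht s hs
    have := uIoc_subset_timeInterval ht hs
    simp only [hu this, hx this]
  refine ⟨h.continuousOn.congr hx, fun t ht => (h.intervalIntegrable t ht).congr (hf ht),
    fun t ht => ?_⟩
  rw [hx ht, hx (zero_mem_timeInterval ht), h.integral_eq t ht,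
    intervalIntegral.integral_congr_ae (Eventually.of_forall fun s hs => hf ht hs)]

theorem mono (h : IsSolution f u x T) (hT : T' ≤ T) : IsSolution f u x T' :=
  ⟨h.continuousOn.mono (timeInterval_mono hT),
    fun t ht => h.intervalIntegrable t (timeInterval_mono hT ht),
    fun t ht => h.integral_eq t (timeInterval_mono hT ht)⟩

theorem shift {T a : ℝ} (h : IsSolution f u x T) (ha : 0 ≤ a) (haT : a < T) :
    IsSolution f (fun s => u (a + s)) (fun s => x (a + s)) ((T - a : ℝ) : EReal) := by
  have hmem : ∀ {t : ℝ}, t ∈ timeInterval ((T - a : ℝ) : EReal) →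
      a + t ∈ timeInterval (T : EReal) := by
    intro t ht
    rw [timeInterval_coe] at ht ⊢
    exact ⟨by linarith [ht.1], by linarith [ht.2]⟩
  have haI : a ∈ timeInterval (T : EReal) := by rw [timeInterval_coe]; exact ⟨ha, haT⟩
  refine ⟨h.continuousOn.comp (by fun_prop) fun t ht => hmem ht, fun t ht => ?_, fun t ht => ?_⟩
  · have := ((h.intervalIntegrable a haI).symm.trans
      (h.intervalIntegrable _ (hmem ht))).comp_add_left a
    simpa using this
  · have h1 := h.integral_eq _ (hmem ht)
    have h2 := h.integral_eq a haI
    have h3 := intervalIntegral.integral_add_adjacent_intervals (h.intervalIntegrable a haI)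
      ((h.intervalIntegrable a haI).symm.trans (h.intervalIntegrable _ (hmem ht)))
    rw [intervalIntegral.integral_comp_add_left (fun s => f (x s) (u s)) a, add_zero, h1, ← h3, h2]
    abel

/-- A continuous linear map intertwining two vector fields along `x` maps `x` to a solution. -/
theorem map {X' U' : Type*} [NormedAddCommGroup X'] [NormedSpace ℝ X'] [CompleteSpace X]
    [CompleteSpace X'] {g : X' → U' → X'} {w : ℝ → U'} (h : IsSolution f u x T) (A : X →L[ℝ] X')
    (hA : ∀ s, A (f (x s) (u s)) = g (A (x s)) (w s)) :
    IsSolution g w (fun s => A (x s)) T := by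
  refine ⟨A.continuous.comp_continuousOn h.continuousOn, fun t ht => ?_, fun t ht => ?_⟩
  · simp only [← hA]
    exact ⟨A.integrable_comp (h.intervalIntegrable t ht).1,
      A.integrable_comp (h.intervalIntegrable t ht).2⟩
  · simp only [← hA]
    rw [A.intervalIntegral_comp_comm (h.intervalIntegrable t ht), ← map_add,
      ← h.integral_eq t ht]

/-- A solution on `[0,T₀)` extends to a right maximally defined one, by Zorn's lemma. -/
theorem exists_isMaximalSolution {T₀ : EReal} (h : IsSolution f u x T₀) (h0 : 0 < T₀)
    (hT : T₀ ≤ T) :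
    ∃ (z : ℝ → X) (T' : EReal), IsMaximalSolution f u T z T' ∧ T₀ ≤ T' ∧
      Set.EqOn z x (timeInterval T₀) := by
  let Ext := {e : EReal × (ℝ → X) // e.1 ≤ T ∧ IsSolution f u e.2 e.1 ∧ T₀ ≤ e.1 ∧
    Set.EqOn e.2 x (timeInterval T₀)}
  let r : Ext → Ext → Prop := fun a b => a.1.1 ≤ b.1.1 ∧ Set.EqOn b.1.2 a.1.2 (timeInterval a.1.1)
  have hr : ∀ {a}, r a a := ⟨le_rfl, fun _ _ => rfl⟩
  let base : Ext := ⟨(T₀, x), hT, h, le_rfl, fun _ _ => rfl⟩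
  have hchain : ∀ c : Set Ext, IsChain r c → ∃ ub, ∀ a ∈ c, r a ub := by
    intro c hc
    rcases c.eq_empty_or_nonempty with rfl | ⟨e₀, he₀⟩
    · exact ⟨base, fun a ha => absurd ha (Set.notMem_empty a)⟩
    -- the common continuation of the chain, defined up to the supremum of the final times
    let S : EReal := sSup ((fun e : Ext => e.1.1) '' c)
    have hle : ∀ e ∈ c, e.1.1 ≤ S := fun e he => le_sSup (Set.mem_image_of_mem _ he)
    have hex : ∀ t ∈ timeInterval S, ∃ e ∈ c, t ∈ timeInterval e.1.1 := by
      intro t ht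
      obtain ⟨_, ⟨e, he, rfl⟩, hlt⟩ := lt_sSup_iff.1 ht.2
      exact ⟨e, he, ht.1, hlt⟩
    classical
    let z : ℝ → X := fun t =>
      if ht : ∃ e ∈ c, t ∈ timeInterval e.1.1 then ht.choose.1.2 t else 0
    have hz : ∀ e ∈ c, Set.EqOn z e.1.2 (timeInterval e.1.1) := by
      intro e he t ht
      have hex' : ∃ e ∈ c, t ∈ timeInterval e.1.1 := ⟨e, he, ht⟩
      have hs := hex'.choose_spec
      simp only [z, dif_pos hex']
      rcases eq_or_ne hex'.choose e with heq | hne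
      · rw [heq]
      · rcases hc hs.1 he hne with h' | h'
        · exact (h'.2 hs.2).symm
        · exact h'.2 ht
    have hzsol : ∀ e ∈ c, IsSolution f u z e.1.1 := fun e he =>
      e.2.2.1.congr (fun _ _ => rfl) (hz e he)
    refine ⟨⟨(S, z), sSup_le (by rintro _ ⟨e, -, rfl⟩; exact e.2.1), ⟨?_, ?_, ?_⟩,
      e₀.2.2.2.1.trans (hle e₀ he₀), fun t ht => ?_⟩, fun e he => ⟨hle e he, hz e he⟩⟩
    · intro t ht
      obtain ⟨e, he, hte⟩ := hex t ht
      refine ((hzsol e he).continuousOn t hte).mono_of_mem_nhdsWithin ?_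
      have hopen : IsOpen {s : ℝ | (s : EReal) < e.1.1} :=
        isOpen_Iio.preimage continuous_coe_real_ereal
      filter_upwards [self_mem_nhdsWithin, mem_nhdsWithin_of_mem_nhds (hopen.mem_nhds hte.2)]
        with s hs hs' using ⟨hs.1, hs'⟩
    · intro t ht
      obtain ⟨e, he, hte⟩ := hex t ht
      exact (hzsol e he).intervalIntegrable t hte
    · intro t ht
      obtain ⟨e, he, hte⟩ := hex t ht
      exact (hzsol e he).integral_eq t hte
    · exact (hz e₀ he₀ (timeInterval_mono e₀.2.2.2.1 ht)).trans (e₀.2.2.2.2 ht)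
  obtain ⟨m, hm⟩ := exists_maximal_of_chains_bounded hchain fun {a b c} hab hbc =>
    ⟨hab.1.trans hbc.1, fun t ht => (hbc.2 (timeInterval_mono hab.1 ht)).trans (hab.2 ht)⟩
  refine ⟨m.1.2, m.1.1, ⟨h0.trans_le m.2.2.2.1, m.2.1, m.2.2.1, fun T'' z hT'' hz hzm => ?_⟩,
    m.2.2.2.1, m.2.2.2.2⟩
  rcases le_total T'' m.1.1 with hle | hle
  · exact hle
  · exact (hm ⟨(T'', z), hT'', hz, m.2.2.2.1.trans hle, fun t ht =>
      (hzm (timeInterval_mono m.2.2.2.1 ht)).trans (m.2.2.2.2 ht)⟩ ⟨hle, hzm⟩).1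

end IsSolution

/-! ### The estimates of a subsystem along an arbitrary solution -/

section Subsystem

variable {X V U Y : Type*} [NormedAddCommGroup X] [NormedSpace ℝ X] [NormedAddCommGroup V]
  [NormedAddCommGroup U] [NormedAddCommGroup Y] {p : ℝ≥0∞}

/-- The piece of `v` on `[a,T)`, moved to start at time `0` and extended by zero. -/
def window (v : ℝ → V) (a T : ℝ) : ℝ → V := fun s => (Set.Ico a T).indicator v (a + s)

theorem window_apply {v : ℝ → V} {a T s : ℝ} (h0 : 0 ≤ s) (hs : s < T - a) :
    window v a T s = v (a + s) :=
  Set.indicator_of_mem (show a + s ∈ Set.Ico a T from ⟨by linarith, by linarith⟩) v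

theorem nnnorm_window_le {v : ℝ → V} {a T : ℝ} {c : ℝ≥0}
    (h : AEBound (fun t => ‖v t‖₊) a T c) : ∀ᵐ s, ‖window v a T s‖₊ ≤ c := by
  filter_upwards [ae_shift h a] with s hs
  by_cases hm : a + s ∈ Set.Ico a T
  · rw [window, Set.indicator_of_mem hm]
    exact hs hm.1 hm.2
  · rw [window, Set.indicator_of_notMem hm]
    simp

theorem isControl_window {v : ℝ → V} {a T : ℝ} {c : ℝ≥0} (ha : 0 ≤ a)
    (hm : AEStronglyMeasurable v (volume.restrict (timeInterval T)))
    (h : AEBound (fun t => ‖v t‖₊) a T c) : IsControl (window v a T) ⊤ := by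
  have h1 : AEStronglyMeasurable ((Set.Ico a T).indicator v) volume := by
    rw [aestronglyMeasurable_indicator_iff measurableSet_Ico]
    refine hm.mono_measure (Measure.restrict_mono ?_ le_rfl)
    rw [timeInterval_coe]
    exact Set.Ico_subset_Ico_left ha
  have h2 : AEStronglyMeasurable (window v a T) volume :=
    h1.comp_measurePreserving (measurePreserving_add_left volume a)
  exact isControl_of_bound h2.restrict ((nnnorm_window_le h).mono fun _ hs _ => hs)

/-- By time invariance, the output estimate can be restarted at any time `a`, along any solution
(not necessarily maximal) on a bounded interval; only the inputs on `[a,T)` matter. -/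
theorem IsIOpSTripleTwoInputs.restart {f : X → V → U → X} {h : X → V → U → Y}
    {β : ℝ≥0 → ℝ≥0 → ℝ≥0} {γy γu : ℝ≥0 → ℝ≥0} {d : ℝ≥0}
    (hS : IsIOpSTripleTwoInputs p f h β γy γu d) {v : ℝ → V} {u : ℝ → U} {x : ℝ → X} {T a : ℝ}
    {c e : ℝ≥0} (hx : IsSolution (jointInput p f) (fun t => WithLp.toLp p (v t, u t)) x T)
    (ha : 0 ≤ a) (haT : a < T)
    (hvm : AEStronglyMeasurable v (volume.restrict (timeInterval T)))
    (hum : AEStronglyMeasurable u (volume.restrict (timeInterval T)))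
    (hv : AEBound (fun t => ‖v t‖₊) a T c) (hu : AEBound (fun t => ‖u t‖₊) a T e) :
    ∀ᵐ t, a ≤ t → t < T →
      ‖h (x t) (v t) (u t)‖₊ ≤ β ‖x a‖₊ (t - a).toNNReal + γy c + γu e + d := by
  have hsol : IsSolution (jointInput p f)
      (fun s => WithLp.toLp p (window v a T s, window u a T s)) (fun s => x (a + s))
      ((T - a : ℝ) : EReal) := by
    refine (hx.shift ha haT).congr (fun s hs => ?_) fun _ _ => rfl
    rw [timeInterval_coe] at hs
    simp only [window_apply hs.1 hs.2]
  obtain ⟨z, T', hz, hT', hzx⟩ := hsol.exists_isMaximalSolution (T := ⊤)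
    (by exact_mod_cast sub_pos.2 haT) le_top
  have hb := hS.bound _ _ (isControl_window ha hvm hv) (isControl_window ha hum hu) z T' hz
  rw [ae_restrict_iff' (measurableSet_timeInterval T')] at hb
  filter_upwards [ae_shift hb (-a)] with t ht hat htT
  have h0 : 0 ≤ -a + t := by linarith
  have h1 : -a + t < T - a := by linarith
  have hmem : -a + t ∈ timeInterval ((T - a : ℝ) : EReal) := by
    rw [timeInterval_coe]; exact ⟨h0, h1⟩
  have h2 := ht (timeInterval_mono hT' hmem)
  rw [hzx hmem, hzx (zero_mem_timeInterval hmem), window_apply h0 h1, window_apply h0 h1] at h2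
  simp only [add_neg_cancel_left, add_zero] at h2
  rw [neg_add_eq_sub] at h2
  refine h2.trans ?_
  gcongr
  · exact hS.classK_y.monotone
      (essNorm_truncate_le ((nnnorm_window_le hv).mono fun s hs _ _ => hs))
  · exact hS.classK_u.monotone (essNorm_le ((nnnorm_window_le hu).mono fun s hs _ => hs))

/-- The state estimate along any solution on a bounded interval: such a solution is right maximally
defined for the control restricted to the same interval. -/
theorem IsUOCouple.state_le [Fact (1 ≤ p)] {f : X → U → X} {h : X → U → Y} {α : ℝ≥0 → ℝ≥0}
    {D : ℝ≥0} (hUO : IsUOCouple p f h α D) {u : ℝ → U} {x : ℝ → X} {T t : ℝ}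
    (hx : IsSolution f u x T) (hu : IsControl u T) (ht0 : 0 ≤ t) (htT : t < T) {c : ℝ≥0}
    (hc : ∀ᵐ s, 0 ≤ s → s ≤ t → ‖u s‖₊ + ‖h (x s) (u s)‖₊ ≤ c) :
    ‖x t‖₊ ≤ α (‖x 0‖₊ + c) + D := by
  have hT : (0 : EReal) < T := by exact_mod_cast ht0.trans_lt htT
  have hmax : IsMaximalSolution f u T x T := ⟨hT, le_rfl, hx, fun _ _ h _ _ => h⟩
  refine (hUO.bound T u hT hu x T hmax t (by rw [timeInterval_coe]; exact ⟨ht0, htT⟩)).trans ?_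
  refine add_le_add (hUO.classK.monotone (add_le_add le_rfl ?_)) le_rfl
  refine essNorm_truncate_le (hc.mono fun s hs h1 h2 => ?_)
  exact (nnnorm_toLp_le _ _).trans (hs h1 h2)

end Subsystem

/-! ### The interconnection -/

section Interconnection

variable {X₁ X₂ U₁ U₂ Y₁ Y₂ : Type*}

/-- The outputs satisfy the implicit loop equations `y₁ = h₁(x₁,y₂,u₁)`, `y₂ = h₂(x₂,y₁,u₂)`: the
pair `(y₁, h₂(x₂,y₁,u₂))` solves the same system as `(y₁,y₂)`, which has only one solution. -/
theorem IsOutputSolution.outputs_eq {h₁ : X₁ → Y₂ → U₁ → Y₁} {h₂ : X₂ → Y₁ → U₂ → Y₂}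
    {h : X₁ → X₂ → U₁ → U₂ → Y₁ × Y₂} (hsol : IsOutputSolution h₁ h₂ h) (x₁ : X₁) (x₂ : X₂)
    (u₁ : U₁) (u₂ : U₂) :
    h₁ x₁ (h x₁ x₂ u₁ u₂).2 u₁ = (h x₁ x₂ u₁ u₂).1 ∧
      h₂ x₂ (h x₁ x₂ u₁ u₂).1 u₂ = (h x₁ x₂ u₁ u₂).2 := by
  set y := h x₁ x₂ u₁ u₂ with hy
  have e₁ := ((hsol x₁ x₂ u₁ u₂ y.1 y.2).1 hy).1
  have e := (hsol x₁ x₂ u₁ u₂ y.1 (h₂ x₂ y.1 u₂)).2 ⟨e₁, by rw [← e₁]⟩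
  have e₂ : h₂ x₂ y.1 u₂ = y.2 := congrArg Prod.snd e
  rw [e₂] at e₁
  exact ⟨e₁.symm, e₂⟩

variable {p : ℝ≥0∞} {f₁ : X₁ → Y₂ → U₁ → X₁} {f₂ : X₂ → Y₁ → U₂ → X₂}
  {h : X₁ → X₂ → U₁ → U₂ → Y₁ × Y₂} {u : ℝ → WithLp p (U₁ × U₂)} {x : ℝ → WithLp p (X₁ × X₂)}

section Components

variable [Fact (1 ≤ p)] [NormedAddCommGroup X₁] [NormedSpace ℝ X₁] [FiniteDimensional ℝ X₁]
  [NormedAddCommGroup X₂] [NormedSpace ℝ X₂] [FiniteDimensional ℝ X₂]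

theorem IsSolution.interField_fst {T : EReal} (hx : IsSolution (interField p f₁ f₂ h) u x T) :
    IsSolution (jointInput p f₁)
      (fun t => WithLp.toLp p (interOutput₂ p h (x t) (u t), (u t).fst))
      (fun t => (x t).fst) T :=
  have : CompleteSpace X₁ := FiniteDimensional.complete ℝ X₁
  have : CompleteSpace X₂ := FiniteDimensional.complete ℝ X₂
  hx.map (WithLp.fstL p ℝ X₁ X₂) fun _ => rfl

theorem IsSolution.interField_snd {T : EReal} (hx : IsSolution (interField p f₁ f₂ h) u x T) :
    IsSolution (jointInput p f₂)
      (fun t => WithLp.toLp p (interOutput₁ p h (x t) (u t), (u t).snd))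
      (fun t => (x t).snd) T :=
  have : CompleteSpace X₁ := FiniteDimensional.complete ℝ X₁
  have : CompleteSpace X₂ := FiniteDimensional.complete ℝ X₂
  hx.map (WithLp.sndL p ℝ X₁ X₂) fun _ => rfl

end Components

variable [NormedAddCommGroup X₁] [NormedAddCommGroup X₂] [NormedAddCommGroup U₁]
  [NormedAddCommGroup U₂] [NormedAddCommGroup Y₁] [NormedAddCommGroup Y₂]

theorem continuous_interOutput_uncurry
    (hh : Continuous fun z : X₁ × X₂ × U₁ × U₂ => h z.1 z.2.1 z.2.2.1 z.2.2.2) :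
    Continuous fun z : WithLp p (X₁ × X₂) × WithLp p (U₁ × U₂) =>
      h z.1.fst z.1.snd z.2.fst z.2.snd := by
  have c₁ := WithLp.continuous_fst p X₁ X₂
  have c₂ := WithLp.continuous_snd p X₁ X₂
  have c₃ := WithLp.continuous_fst p U₁ U₂
  have c₄ := WithLp.continuous_snd p U₁ U₂
  exact hh.comp ((c₁.comp continuous_fst).prodMk ((c₂.comp continuous_fst).prodMk
    ((c₃.comp continuous_snd).prodMk (c₄.comp continuous_snd))))

variable [Fact (1 ≤ p)]

theorem aestronglyMeasurable_interOutput {T : EReal}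
    (hh : Continuous fun z : X₁ × X₂ × U₁ × U₂ => h z.1 z.2.1 z.2.2.1 z.2.2.2)
    (hx : ContinuousOn x (timeInterval T)) (hu : IsControl u T) :
    AEStronglyMeasurable (fun t => h (x t).fst (x t).snd (u t).fst (u t).snd)
      (volume.restrict (timeInterval T)) :=
  (continuous_interOutput_uncurry hh).comp_aestronglyMeasurable
    ((hx.aestronglyMeasurable (measurableSet_timeInterval T)).prodMk hu.1)

/-- Strictly inside the interval of definition of the solution the outputs are admissible inputs for
the subsystems: they are essentially bounded because states and external inputs stay in a compact
set. -/
theorem isControl_interOutput [NormedSpace ℝ U₁] [FiniteDimensional ℝ U₁] [NormedSpace ℝ U₂]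
    [FiniteDimensional ℝ U₂] {T : ℝ} {T' : EReal}
    (hh : Continuous fun z : X₁ × X₂ × U₁ × U₂ => h z.1 z.2.1 z.2.2.1 z.2.2.2)
    (hx : ContinuousOn x (timeInterval T')) (hT : (T : EReal) < T') (hu : IsControl u T) :
    IsControl (fun t => interOutput₁ p h (x t) (u t)) T ∧
      IsControl (fun t => interOutput₂ p h (x t) (u t)) T := by
  obtain ⟨C, hC⟩ := hu.exists_bound
  have : FiniteDimensional ℝ (WithLp p (U₁ × U₂)) :=
    (WithLp.prodContinuousLinearEquiv p ℝ U₁ U₂).toLinearEquiv.symm.finiteDimensional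
  have : ProperSpace (WithLp p (U₁ × U₂)) := FiniteDimensional.proper ℝ _
  have hsub : Set.Icc 0 T ⊆ timeInterval T' := fun t ht =>
    ⟨ht.1, (EReal.coe_le_coe_iff.2 ht.2).trans_lt hT⟩
  have hK := (isCompact_Icc.image_of_continuousOn (hx.mono hsub)).prod
    (isCompact_closedBall (0 : WithLp p (U₁ × U₂)) C)
  obtain ⟨c, hc⟩ := hK.exists_bound_of_continuousOn
    (continuous_interOutput_uncurry hh).continuousOn
  have hm := aestronglyMeasurable_interOutput hh (hx.mono (timeInterval_mono hT.le)) hu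
  have hb : ∀ᵐ t, t ∈ timeInterval (T : EReal) →
      ‖h (x t).fst (x t).snd (u t).fst (u t).snd‖ ≤ c := by
    filter_upwards [hC] with t ht htT
    have hut : u t ∈ Metric.closedBall (0 : WithLp p (U₁ × U₂)) C := by
      rw [mem_closedBall_zero_iff]
      exact ht htT
    rw [timeInterval_coe] at htT
    exact hc (x t, u t) ⟨⟨t, ⟨htT.1, htT.2.le⟩, rfl⟩, hut⟩
  exact ⟨isControl_of_bound (c := c.toNNReal) hm.fst (hb.mono fun t h ht =>
      NNReal.le_toNNReal_of_coe_le ((norm_fst_le _).trans (h ht))),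
    isControl_of_bound (c := c.toNNReal) hm.snd (hb.mono fun t h ht =>
      NNReal.le_toNNReal_of_coe_le ((norm_snd_le _).trans (h ht)))⟩

variable [NormedSpace ℝ X₁] [NormedSpace ℝ X₂]

/-- The assumptions of the small-gain theorem on the two subsystems and on their output map. -/
structure IsStableLoop (p : ℝ≥0∞) [Fact (1 ≤ p)] (f₁ : X₁ → Y₂ → U₁ → X₁) (h₁ : X₁ → Y₂ → U₁ → Y₁)
    (f₂ : X₂ → Y₁ → U₂ → X₂) (h₂ : X₂ → Y₁ → U₂ → Y₂) (h : X₁ → X₂ → U₁ → U₂ → Y₁ × Y₂)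
    (L : LoopData) : Prop where
  continuous : Continuous fun z : X₁ × X₂ × U₁ × U₂ => h z.1 z.2.1 z.2.2.1 z.2.2.2
  isOutputSolution : IsOutputSolution h₁ h₂ h
  output₁ : IsIOpSTripleTwoInputs p f₁ h₁ L.β₁ L.γ₁y L.γ₁u L.d₁
  output₂ : IsIOpSTripleTwoInputs p f₂ h₂ L.β₂ L.γ₂y L.γ₂u L.d₂
  state₁ : IsUOCouple p (jointInput p f₁) (jointInput p h₁) L.α₁ L.D₁
  state₂ : IsUOCouple p (jointInput p f₂) (jointInput p h₂) L.α₂ L.D₂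

namespace IsStableLoop

variable {h₁ : X₁ → Y₂ → U₁ → Y₁} {h₂ : X₂ → Y₁ → U₂ → Y₂} {L : LoopData}

theorem regular (H : IsStableLoop p f₁ h₁ f₂ h₂ h L) : L.Regular :=
  ⟨H.output₁.classKL, H.output₂.classKL, H.output₁.classK_y, H.output₁.classK_u,
    H.output₂.classK_y, H.output₂.classK_u, H.state₁.classK, H.state₂.classK⟩

variable [FiniteDimensional ℝ X₁] [FiniteDimensional ℝ X₂] [NormedSpace ℝ U₁]
  [FiniteDimensional ℝ U₁] [NormedSpace ℝ U₂] [FiniteDimensional ℝ U₂]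

/-- The state estimates of the two subsystems in terms of a common bound on the inputs and
outputs. -/
theorem state_le (H : IsStableLoop p f₁ h₁ f₂ h₂ h L) {T t : ℝ} {T' : EReal}
    (hx : IsSolution (interField p f₁ f₂ h) u x T') (hT : (T : EReal) < T') (hu : IsControl u T)
    (ht0 : 0 ≤ t) (htT : t < T) {V₁ V₂ W : ℝ≥0}
    (hy₁ : ∀ᵐ s, 0 ≤ s → s ≤ t → ‖interOutput₁ p h (x s) (u s)‖₊ ≤ V₁)
    (hy₂ : ∀ᵐ s, 0 ≤ s → s ≤ t → ‖interOutput₂ p h (x s) (u s)‖₊ ≤ V₂)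
    (hW : ∀ᵐ s, 0 ≤ s → s ≤ t → ‖u s‖₊ ≤ W) :
    ‖(x t).fst‖₊ ≤ L.α₁ (‖(x 0).fst‖₊ + (V₁ + V₂ + W)) + L.D₁ ∧
      ‖(x t).snd‖₊ ≤ L.α₂ (‖(x 0).snd‖₊ + (V₁ + V₂ + W)) + L.D₂ := by
  have hxT := hx.mono hT.le
  obtain ⟨c₁, c₂⟩ := isControl_interOutput H.continuous hx.continuousOn hT hu
  constructor
  · refine H.state₁.state_le hxT.interField_fst (c₂.toLp hu.fst) ht0 htT ?_
    filter_upwards [hy₁, hy₂, hW] with s e₁ e₂ e₃ hs0 hst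
    have e := (H.isOutputSolution.outputs_eq (x s).fst (x s).snd (u s).fst (u s).snd).1
    have e₄ : ‖jointInput p h₁ (x s).fst
        (WithLp.toLp p (interOutput₂ p h (x s) (u s), (u s).fst))‖₊ ≤ V₁ := by
      refine le_trans (le_of_eq ?_) (e₁ hs0 hst)
      exact congrArg _ e
    calc _ ≤ (V₂ + W) + V₁ := add_le_add ((nnnorm_toLp_le _ _).trans
          (add_le_add (e₂ hs0 hst) ((WithLp.nnnorm_fst_le _ _).trans (e₃ hs0 hst)))) e₄
      _ = _ := by ring
  · refine H.state₂.state_le hxT.interField_snd (c₁.toLp hu.snd) ht0 htT ?_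
    filter_upwards [hy₁, hy₂, hW] with s e₁ e₂ e₃ hs0 hst
    have e := (H.isOutputSolution.outputs_eq (x s).fst (x s).snd (u s).fst (u s).snd).2
    have e₄ : ‖jointInput p h₂ (x s).snd
        (WithLp.toLp p (interOutput₁ p h (x s) (u s), (u s).snd))‖₊ ≤ V₂ := by
      refine le_trans (le_of_eq ?_) (e₂ hs0 hst)
      exact congrArg _ e
    calc _ ≤ (V₁ + W) + V₂ := add_le_add ((nnnorm_toLp_le _ _).trans
          (add_le_add (e₁ hs0 hst) ((WithLp.nnnorm_snd_le _ _).trans (e₃ hs0 hst)))) e₄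
      _ = _ := by ring

/-- The norms along a solution of the interconnection form a trajectory of the loop on every bounded
interval strictly inside the interval of definition. -/
theorem loopTrajectory (H : IsStableLoop p f₁ h₁ f₂ h₂ h L) {T : ℝ} {T' : EReal}
    (hx : IsSolution (interField p f₁ f₂ h) u x T') (hT : (T : EReal) < T') (hu : IsControl u T)
    {W : ℝ≥0} (hW : AEBound (fun t => ‖u t‖₊) 0 T W) :
    LoopTrajectory L W T (fun t => ‖(x t).fst‖₊) (fun t => ‖(x t).snd‖₊)
      (fun t => ‖interOutput₁ p h (x t) (u t)‖₊) (fun t => ‖interOutput₂ p h (x t) (u t)‖₊) := by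
  have hxT := hx.mono hT.le
  obtain ⟨c₁, c₂⟩ := isControl_interOutput H.continuous hx.continuousOn hT hu
  have hst : ∀ V₁ V₂, AEBound (fun t => ‖interOutput₁ p h (x t) (u t)‖₊) 0 T V₁ →
      AEBound (fun t => ‖interOutput₂ p h (x t) (u t)‖₊) 0 T V₂ → ∀ t, 0 ≤ t → t < T →
      ‖(x t).fst‖₊ ≤ L.α₁ (‖(x 0).fst‖₊ + (V₁ + V₂ + W)) + L.D₁ ∧
      ‖(x t).snd‖₊ ≤ L.α₂ (‖(x 0).snd‖₊ + (V₁ + V₂ + W)) + L.D₂ := fun V₁ V₂ b₁ b₂ t ht0 htT =>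
    H.state_le hx hT hu ht0 htT (Eventually.mono b₁ fun s hs h0 h1 => hs h0 (h1.trans_lt htT))
      (Eventually.mono b₂ fun s hs h0 h1 => hs h0 (h1.trans_lt htT))
      (Eventually.mono hW fun s hs h0 h1 => hs h0 (h1.trans_lt htT))
  refine ⟨c₁.exists_aeBound, c₂.exists_aeBound,
    fun a V ha haT hV => ?_, fun a V ha haT hV => ?_,
    fun V₁ V₂ b₁ b₂ t ht0 htT => (hst V₁ V₂ b₁ b₂ t ht0 htT).1,
    fun V₁ V₂ b₁ b₂ t ht0 htT => (hst V₁ V₂ b₁ b₂ t ht0 htT).2⟩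
  · have hW₁ : AEBound (fun t => ‖(u t).fst‖₊) a T W :=
      Eventually.mono hW fun s hs h0 h1 =>
      (WithLp.nnnorm_fst_le _ _).trans (hs (ha.trans h0) h1)
    filter_upwards [H.output₁.restart hxT.interField_fst ha haT c₂.1 hu.fst.1 hV hW₁]
      with t ht h0 h1
    have e := (H.isOutputSolution.outputs_eq (x t).fst (x t).snd (u t).fst (u t).snd).1
    exact le_trans (le_of_eq (congrArg _ e.symm)) (ht h0 h1)
  · have hW₂ : AEBound (fun t => ‖(u t).snd‖₊) a T W :=
      Eventually.mono hW fun s hs h0 h1 =>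
      (WithLp.nnnorm_snd_le _ _).trans (hs (ha.trans h0) h1)
    filter_upwards [H.output₂.restart hxT.interField_snd ha haT c₁.1 hu.snd.1 hV hW₂]
      with t ht h0 h1
    have e := (H.isOutputSolution.outputs_eq (x t).fst (x t).snd (u t).fst (u t).snd).2
    exact le_trans (le_of_eq (congrArg _ e.symm)) (ht h0 h1)

/-- The interconnection has the UO property: its state is estimated through the joint input and
output, which dominate the inputs and outputs of both subsystems. -/
theorem isUOCouple (H : IsStableLoop p f₁ h₁ f₂ h₂ h L) :
    IsUOCouple p (interField p f₁ f₂ h) (interOutput p h)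
      ((fun s => L.α₁ (3 * s)) + fun s => L.α₂ (3 * s)) (L.D₁ + L.D₂) := by
  have h3 : IsClassK fun s : ℝ≥0 => 3 * s :=
    ⟨by fun_prop, fun a b hab => mul_lt_mul_of_pos_left hab (by norm_num), by simp⟩
  refine ⟨(H.regular.α₁.comp h3).add (H.regular.α₂.comp h3), fun T u hT hu x T' hx t ht => ?_⟩
  -- a final time `b` strictly inside `[0,T')`, where the outputs are still essentially bounded
  obtain ⟨b, htb, hb⟩ := EReal.lt_iff_exists_real_btwn.1 ht.2
  have htb' : t < b := EReal.coe_lt_coe_iff.1 htb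
  have hub : IsControl u b := hu.mono (hb.le.trans hx.le)
  obtain ⟨c₁, c₂⟩ := isControl_interOutput H.continuous hx.isSolution.continuousOn hb hub
  set w : ℝ → WithLp p (WithLp p (U₁ × U₂) × WithLp p (Y₁ × Y₂)) :=
    fun s => WithLp.toLp p (u s, interOutput p h (x s) (u s)) with hw
  obtain ⟨c, hc⟩ := (hub.toLp (p := p) (c₁.toLp (p := p) c₂)).exists_bound
  rw [timeInterval_coe] at hc
  have hwb : ∀ᵐ s, 0 ≤ s → s ≤ t → ‖w s‖₊ ≤ c :=
    hc.mono fun s hs h0 hst => hs ⟨h0, hst.trans_lt htb'⟩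
  set N := essNorm (truncate w t) with hN
  have hle : ∀ᵐ s, 0 ≤ s → s ≤ t → ‖w s‖₊ ≤ N := ae_le_essNorm_truncate hwb
  have hle' : ∀ᵐ s, 0 ≤ s → s ≤ t → ‖interOutput p h (x s) (u s)‖₊ ≤ N :=
    hle.mono fun s hs h0 h1 => (WithLp.nnnorm_snd_le _ (w s)).trans (hs h0 h1)
  have key := H.state_le hx.isSolution hb hub ht.1 htb'
    (hle'.mono fun s hs h0 h1 =>
      (WithLp.nnnorm_fst_le _ (interOutput p h (x s) (u s))).trans (hs h0 h1))
    (hle'.mono fun s hs h0 h1 =>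
      (WithLp.nnnorm_snd_le _ (interOutput p h (x s) (u s))).trans (hs h0 h1))
    (hle.mono fun s hs h0 h1 => (WithLp.nnnorm_fst_le _ (w s)).trans (hs h0 h1))
  have harg : ∀ {a : ℝ≥0}, a ≤ ‖x 0‖₊ → a + (N + N + N) ≤ 3 * (‖x 0‖₊ + N) := by
    intro a ha
    calc a + (N + N + N) ≤ ‖x 0‖₊ + (N + N + N) + 2 * ‖x 0‖₊ :=
          (add_le_add ha le_rfl).trans le_self_add
      _ = _ := by ring
  calc ‖x t‖₊ ≤ ‖(x t).fst‖₊ + ‖(x t).snd‖₊ := nnnorm_toLp_le (x t).fst (x t).snd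
    _ ≤ (L.α₁ (3 * (‖x 0‖₊ + N)) + L.D₁) + (L.α₂ (3 * (‖x 0‖₊ + N)) + L.D₂) :=
        add_le_add
          (key.1.trans (add_le_add
            (H.regular.α₁.monotone (harg (WithLp.nnnorm_fst_le _ _))) le_rfl))
          (key.2.trans (add_le_add
            (H.regular.α₂.monotone (harg (WithLp.nnnorm_snd_le _ _))) le_rfl))
    _ = _ := by simp only [Pi.add_apply]; ring

/-- An output of the interconnection satisfies an IOpS estimate as soon as it satisfies the
corresponding estimate on all bounded intervals on which the norms form a trajectory of the loop. -/
theorem isIOpSTriple_of_loopTrajectory {Z : Type*} [NormedAddCommGroup Z]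
    (H : IsStableLoop p f₁ h₁ f₂ h₂ h L)
    {k : WithLp p (X₁ × X₂) → WithLp p (U₁ × U₂) → Z} {β : ℝ≥0 → ℝ≥0 → ℝ≥0} {γ : ℝ≥0 → ℝ≥0}
    {d : ℝ≥0} (hβ : IsClassKL β) (hγ : IsClassK γ)
    (hk : ∀ (u : ℝ → WithLp p (U₁ × U₂)) (x : ℝ → WithLp p (X₁ × X₂)) (W : ℝ≥0) (T : ℝ),
      LoopTrajectory L W T (fun t => ‖(x t).fst‖₊) (fun t => ‖(x t).snd‖₊)
        (fun t => ‖interOutput₁ p h (x t) (u t)‖₊) (fun t => ‖interOutput₂ p h (x t) (u t)‖₊) →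
      ∀ᵐ t, 0 ≤ t → t < T → ‖k (x t) (u t)‖₊ ≤ β ‖x 0‖₊ t.toNNReal + γ W + d) :
    IsIOpSTriple (interField p f₁ f₂ h) k β γ d := by
  refine ⟨hβ, hγ, fun u hu x T' hx => ?_⟩
  have hu' := hu.2.ne
  rw [timeInterval_top] at hu'
  -- rational final times exhaust `[0,T')` and are countably many
  have hall : ∀ q : ℚ, ((q : ℝ) : EReal) < T' → ∀ᵐ t, 0 ≤ t → t < (q : ℝ) →
      ‖k (x t) (u t)‖₊ ≤ β ‖x 0‖₊ t.toNNReal + γ (essNorm u) + d := fun q hq =>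
    hk u x _ q (H.loopTrajectory hx.isSolution hq (hu.mono le_top)
      ((ae_le_essNorm hu').mono fun s hs h0 _ => hs h0))
  rw [ae_restrict_iff' (measurableSet_timeInterval T')]
  filter_upwards [ae_all_iff.2 fun q => eventually_imp_distrib_left.2 (hall q)] with t h ht
  obtain ⟨q, htq, hqT⟩ := EReal.lt_iff_exists_rat_btwn.1 ht.2
  exact h q hqT ht.1 (EReal.coe_lt_coe_iff.1 htq)

/-- The IOpS estimates with the gains of the small-gain theorem.  Both outputs are treated alike, so
that `r₃₂` may be any function of class `K∞`; the function `r₃₁` itself serves. -/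
theorem exists_isIOpSTriple (H : IsStableLoop p f₁ h₁ f₂ h₂ h L) {ρ₁ ρ₂ ρ₃ r₃₁ : ℝ≥0 → ℝ≥0}
    {sl : ℝ≥0} (hG : L.SmallGain ρ₁ ρ₂ ρ₃ sl) (hr : IsClassKInf r₃₁) :
    ∃ (β₁' β₂' : ℝ≥0 → ℝ≥0 → ℝ≥0) (r₃₂ : ℝ≥0 → ℝ≥0) (d₁' d₂' : ℝ≥0),
      IsClassKL β₁' ∧ IsClassKL β₂' ∧ IsClassK r₃₂ ∧
      (sl = 0 ∧ L.d₁ = 0 ∧ L.d₂ = 0 → d₁' = 0 ∧ d₂' = 0) ∧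
      IsIOpSTriple (interField p f₁ f₂ h) (interOutput p h) (β₁' + β₂')
        (L.gain ρ₁ ρ₂ ρ₃ + L.swap.gain ρ₂ ρ₁ ρ₃ + r₃₁ + r₃₂) (d₁' + d₂') ∧
      IsIOpSTriple (interField p f₁ f₂ h) (interOutput₁ p h) β₁' (L.gain ρ₁ ρ₂ ρ₃ + r₃₁) d₁' ∧
      IsIOpSTriple (interField p f₁ f₂ h) (interOutput₂ p h) β₂'
        (L.swap.gain ρ₂ ρ₁ ρ₃ + r₃₂) d₂' := by
  obtain ⟨β₁', hβ₁, b₁⟩ := LoopData.exists_classKL_bound H.regular hG hr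
  obtain ⟨β₂', hβ₂, b₂⟩ := LoopData.exists_classKL_bound H.regular.swap hG.swap hr
  have g₁ := H.regular.gain hG
  have g₂ := H.regular.swap.gain hG.swap
  refine ⟨β₁', β₂', r₃₁, L.offset ρ₁ ρ₂ ρ₃ sl, L.swap.offset ρ₂ ρ₁ ρ₃ sl, hβ₁, hβ₂,
    hr.toIsClassK, ?_, ?_, ?_, ?_⟩
  · rintro ⟨h0, h1, h2⟩
    constructor
    · simp [LoopData.offset, h0, h1, h2,
        offsetGain_zero hG.margin₁ hG.margin₂ hG.margin₃ H.regular.γ₁y]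
    · simp [LoopData.offset, LoopData.swap, h0, h1, h2,
        offsetGain_zero hG.margin₂ hG.margin₁ hG.margin₃ H.regular.γ₂y]
  · refine H.isIOpSTriple_of_loopTrajectory (hβ₁.add hβ₂)
      (((g₁.add g₂).add hr.toIsClassK).add hr.toIsClassK) fun u x W T ht => ?_
    filter_upwards [b₁ ht (WithLp.nnnorm_fst_le _ (x 0)) (WithLp.nnnorm_snd_le _ (x 0)),
      b₂ ht.swap (WithLp.nnnorm_snd_le _ (x 0)) (WithLp.nnnorm_fst_le _ (x 0))] with t e₁ e₂ h0 h1
    refine (nnnorm_toLp_le _ _).trans ((add_le_add (e₁ h0 h1) (e₂ h0 h1)).trans_eq ?_)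
    simp only [Pi.add_apply]
    ring
  · exact H.isIOpSTriple_of_loopTrajectory hβ₁ (g₁.add hr.toIsClassK) fun u x W T ht =>
      b₁ ht (WithLp.nnnorm_fst_le _ (x 0)) (WithLp.nnnorm_snd_le _ (x 0))
  · exact H.isIOpSTriple_of_loopTrajectory hβ₂ (g₂.add hr.toIsClassK) fun u x W T ht =>
      b₂ ht.swap (WithLp.nnnorm_snd_le _ (x 0)) (WithLp.nnnorm_fst_le _ (x 0))

end IsStableLoop

end Interconnection

end

theorem theorem2p1
    {X₁ X₂ U₁ U₂ Y₁ Y₂ : Type*}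
    [NormedAddCommGroup X₁] [NormedSpace ℝ X₁] [FiniteDimensional ℝ X₁]
    [NormedAddCommGroup X₂] [NormedSpace ℝ X₂] [FiniteDimensional ℝ X₂]
    [NormedAddCommGroup U₁] [NormedSpace ℝ U₁] [FiniteDimensional ℝ U₁]
    [NormedAddCommGroup U₂] [NormedSpace ℝ U₂] [FiniteDimensional ℝ U₂]
    [NormedAddCommGroup Y₁] [NormedSpace ℝ Y₁] [FiniteDimensional ℝ Y₁]
    [NormedAddCommGroup Y₂] [NormedSpace ℝ Y₂] [FiniteDimensional ℝ Y₂]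
    (p : ℝ≥0∞) [Fact (1 ≤ p)]
    (f₁ : X₁ → Y₂ → U₁ → X₁) (h₁ : X₁ → Y₂ → U₁ → Y₁)
    (f₂ : X₂ → Y₁ → U₂ → X₂) (h₂ : X₂ → Y₁ → U₂ → Y₂)
    (h : X₁ → X₂ → U₁ → U₂ → Y₁ × Y₂)
    (hf₁ : ContDiff ℝ (⊤ : ℕ∞) fun z : X₁ × Y₂ × U₁ => f₁ z.1 z.2.1 z.2.2)
    (hh₁ : ContDiff ℝ (⊤ : ℕ∞) fun z : X₁ × Y₂ × U₁ => h₁ z.1 z.2.1 z.2.2)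
    (hf₂ : ContDiff ℝ (⊤ : ℕ∞) fun z : X₂ × Y₁ × U₂ => f₂ z.1 z.2.1 z.2.2)
    (hh₂ : ContDiff ℝ (⊤ : ℕ∞) fun z : X₂ × Y₁ × U₂ => h₂ z.1 z.2.1 z.2.2)
    (hh : ContDiff ℝ (⊤ : ℕ∞) fun z : X₁ × X₂ × U₁ × U₂ => h z.1 z.2.1 z.2.2.1 z.2.2.2)
    (hsol : IsOutputSolution h₁ h₂ h)
    (β₁ β₂ : ℝ≥0 → ℝ≥0 → ℝ≥0) (γ₁y γ₁u γ₂y γ₂u : ℝ≥0 → ℝ≥0) (d₁ d₂ : ℝ≥0)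
    (hIOpS₁ : IsIOpSTripleTwoInputs p f₁ h₁ β₁ γ₁y γ₁u d₁)
    (hIOpS₂ : IsIOpSTripleTwoInputs p f₂ h₂ β₂ γ₂y γ₂u d₂)
    (α₁ α₂ : ℝ≥0 → ℝ≥0) (D₁ D₂ : ℝ≥0)
    (hUO₁ : IsUOCouple p (jointInput p f₁) (jointInput p h₁) α₁ D₁)
    (hUO₂ : IsUOCouple p (jointInput p f₂) (jointInput p h₂) α₂ D₂)
    (ρ₁ ρ₂ : ℝ≥0 → ℝ≥0) (hρ₁ : IsClassKInf ρ₁) (hρ₂ : IsClassKInf ρ₂) (sl : ℝ≥0)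
    (hgain₁ : ∀ s, sl ≤ s → (idAdd ρ₂ ∘ γ₂y ∘ idAdd ρ₁ ∘ γ₁y) s ≤ s)
    (hgain₂ : ∀ s, sl ≤ s → (idAdd ρ₁ ∘ γ₁y ∘ idAdd ρ₂ ∘ γ₂y) s ≤ s) :
    (IsIOpS (interField p f₁ f₂ h) (interOutput p h) ∧
      IsUO p (interField p f₁ f₂ h) (interOutput p h)) ∧
    (sl = 0 ∧ d₁ = 0 ∧ d₂ = 0 ∧ D₁ = 0 ∧ D₂ = 0 →
      IsIOS (interField p f₁ f₂ h) (interOutput p h) ∧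
      ∃ α : ℝ≥0 → ℝ≥0, IsUOCouple p (interField p f₁ f₂ h) (interOutput p h) α 0) ∧
    (∀ ρ₃ r₃₁ : ℝ≥0 → ℝ≥0, IsClassKInf ρ₃ → IsClassKInf r₃₁ →
      ∃ (β₁' β₂' : ℝ≥0 → ℝ≥0 → ℝ≥0) (r₃₂ : ℝ≥0 → ℝ≥0) (d₁' d₂' : ℝ≥0),
        IsClassKL β₁' ∧ IsClassKL β₂' ∧ IsClassK r₃₂ ∧
        (sl = 0 ∧ d₁ = 0 ∧ d₂ = 0 ∧ D₁ = 0 ∧ D₂ = 0 → d₁' = 0 ∧ d₂' = 0) ∧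
        IsIOpSTriple (interField p f₁ f₂ h) (interOutput p h) (β₁' + β₂')
          (loopGain ρ₁ ρ₂ ρ₃ γ₁y γ₁u γ₂u + loopGain ρ₂ ρ₁ ρ₃ γ₂y γ₂u γ₁u + r₃₁ + r₃₂)
          (d₁' + d₂') ∧
        IsIOpSTriple (interField p f₁ f₂ h) (interOutput₁ p h) β₁'
          (loopGain ρ₁ ρ₂ ρ₃ γ₁y γ₁u γ₂u + r₃₁) d₁' ∧
        IsIOpSTriple (interField p f₁ f₂ h) (interOutput₂ p h) β₂'
          (loopGain ρ₂ ρ₁ ρ₃ γ₂y γ₂u γ₁u + r₃₂) d₂') := by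
  have H : IsStableLoop p f₁ h₁ f₂ h₂ h
      ⟨β₁, β₂, γ₁y, γ₁u, γ₂y, γ₂u, α₁, α₂, d₁, d₂, D₁, D₂⟩ :=
    ⟨hh.continuous, hsol, hIOpS₁, hIOpS₂, hUO₁, hUO₂⟩
  have main := fun ρ₃ (r₃₁ : ℝ≥0 → ℝ≥0) (hρ₃ : IsClassKInf ρ₃) =>
    H.exists_isIOpSTriple (r₃₁ := r₃₁) ⟨hρ₁, hρ₂, hρ₃, hgain₂, hgain₁⟩
  obtain ⟨β₁', β₂', r₃₂, d₁', d₂', -, -, -, hd, hS, -, -⟩ :=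
    main _ _ IsClassKInf.id IsClassKInf.id
  refine ⟨⟨⟨_, _, _, hS⟩, _, _, H.isUOCouple⟩, ?_, ?_⟩
  · rintro ⟨h0, hd₁, hd₂, hD₁, hD₂⟩
    obtain ⟨e₁, e₂⟩ := hd ⟨h0, hd₁, hd₂⟩
    have hU := H.isUOCouple
    rw [e₁, e₂, add_zero] at hS
    simp only [hD₁, hD₂, add_zero] at hU
    exact ⟨⟨_, _, hS⟩, _, hU⟩
  · intro ρ₃ r₃₁ hρ₃ hr
    obtain ⟨β₁', β₂', r₃₂, d₁', d₂', a₁, a₂, a₃, hd, hS⟩ := main ρ₃ r₃₁ hρ₃ hr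
    exact ⟨β₁', β₂', r₃₂, d₁', d₂', a₁, a₂, a₃, fun ⟨h0, h1, h2, _, _⟩ => hd ⟨h0, h1, h2⟩, hS⟩
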